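/- A convex $d$-polytope is the convex hull of a finite set of points in the Euclidean space $\mathbb{R}^d$ whose affine span is all of $\mathbb{R}^d$. For a convex $d$-polytope $P$, let $G(P)$ be its geometric symmetry group, that is, the group of all isometries of $\mathbb{R}^d$ that map $P$ onto itself, and let $\Gamma(P)$ be its combinatorial symmetry group, that is, the group of all automorphisms of the face lattice of $P$. For a group $\Gamma$, let $\operatorname{gcpd}(\Gamma)$ be the minimum $d\ge 0$ such that $G(P)\cong\Gamma$ for some convex $d$-polytope $P$, and let $\operatorname{cpd}(\Gamma)$ be the minimum $d\ge 0$ such that $\Gamma(P)\cong\Gamma$ for some convex $d$-polytope $P$ (each is $\infty$ if there is no such $d$). Proposition 4.1. Let $\Gamma$ be a group. If $\operatorname{gcpd}(\Gamma)\ge 3$, then $\operatorname{cpd}(\Gamma)\le\operatorname{gcpd}(\Gamma)$. Moreover, for every integer $d\ge 3$, if $\Gamma\cong G(P)$ for some convex $d$-polytope $P$, then $\Gamma\cong\Gamma(Q)$ for some convex $d$-polytope $Q$. -/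

import Mathlib

/-- `P` is a convex `d`-polytope in `ℝ^d`: the convex hull of a finite set of points of the
Euclidean space `ℝ^d`, of full dimension `d` (its affine span is all of `ℝ^d`). -/
def IsConvexPolytope {d : ℕ} (P : Set (EuclideanSpace ℝ (Fin d))) : Prop :=
  (∃ V : Set (EuclideanSpace ℝ (Fin d)), V.Finite ∧ P = convexHull ℝ V) ∧
    affineSpan ℝ P = ⊤

/-- The geometric symmetry group `G(P)`: all Euclidean isometries of the ambient space `ℝ^d`
that map `P` onto itself. -/
def geometricSymmetryGroup {d : ℕ} (P : Set (EuclideanSpace ℝ (Fin d))) :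
    Subgroup (EuclideanSpace ℝ (Fin d) ≃ᵢ EuclideanSpace ℝ (Fin d)) where
  carrier := {g | g '' P = P}
  one_mem' := by
    change (fun x => x) '' P = P
    exact Set.image_id' P
  mul_mem' := by
    intro a b ha hb
    change (fun x => a (b x)) '' P = P
    change a '' P = P at ha
    change b '' P = P at hb
    rw [← Set.image_image a b, hb, ha]
  inv_mem' := by
    intro a ha
    change a '' P = P at ha
    change a.symm '' P = P
    calc a.symm '' P = a.symm '' (a '' P) := by rw [ha]
      _ = P := by rw [Set.image_image]; simp

/-- The face lattice of `P`, ordered by inclusion. A face is either empty or the set of points of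
`P` at which some linear functional attains its maximum over `P`; the empty face and `P` itself
(zero functional) are both included. -/
abbrev FaceLattice {d : ℕ} (P : Set (EuclideanSpace ℝ (Fin d))) : Type :=
  {F : Set (EuclideanSpace ℝ (Fin d)) // IsExposed ℝ P F}

/-- The combinatorial symmetry group `Γ(P)`: all automorphisms of the face lattice of `P`,
with composition as the group operation. -/
abbrev CombinatorialSymmetryGroup {d : ℕ} (P : Set (EuclideanSpace ℝ (Fin d))) : Type :=
  FaceLattice P ≃o FaceLattice P

/-- `Γ` is isomorphic to the combinatorial symmetry group of some convex `d`-polytope. -/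
def IsCombinatorialGroupInDim (Γ : Type*) [Group Γ] (d : ℕ) : Prop :=
  ∃ P : Set (EuclideanSpace ℝ (Fin d)),
    IsConvexPolytope P ∧ Nonempty (CombinatorialSymmetryGroup P ≃* Γ)

/-- `Γ` is isomorphic to the geometric symmetry group of some convex `d`-polytope. -/
def IsGeometricGroupInDim (Γ : Type*) [Group Γ] (d : ℕ) : Prop :=
  ∃ P : Set (EuclideanSpace ℝ (Fin d)),
    IsConvexPolytope P ∧ Nonempty (geometricSymmetryGroup P ≃* Γ)

/-- The convex polytope dimension of `Γ`: the least `d` such that `Γ` is the combinatorial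
symmetry group of a convex `d`-polytope (`⊤` if there is no such `d`). -/
noncomputable def cpd (Γ : Type*) [Group Γ] : ℕ∞ :=
  ⨅ (d : ℕ) (_ : IsCombinatorialGroupInDim Γ d), (d : ℕ∞)

/-- The geometric convex polytope dimension of `Γ`: the least `d` such that `Γ` is the geometric
symmetry group of a convex `d`-polytope (`⊤` if there is no such `d`). -/
noncomputable def gcpd (Γ : Type*) [Group Γ] : ℕ∞ :=
  ⨅ (d : ℕ) (_ : IsGeometricGroupInDim Γ d), (d : ℕ∞)

/-! Let `X` be the vertex set of the given polytope and `G` its symmetry group, which is finite. `G`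
fixes a point `o`, and some vector `u` based at `o` has trivial stabilizer. Far out at `z = o + R •
u` attach a corner: `z`, one point on each of `d` edges leaving `z`, and many further points in each
of the `d` coordinate hyperplanes through `z`. Adjoin the whole `G`-orbit of the corner to `X`. For
large `R`, everything outside the corner lies strictly inside the orthant at `z`, so `z` is a simple
vertex and its `d` facets contain corner points only. `G` acts on the new polytope `Q`, and every
combinatorial automorphism of `Q` comes from `G`, for two reasons.

Counting (`map_facet`): the extra points lie on moment curves, so an affine function that is not a
multiple of a coordinate has few zeros on the corner (`cornerSet_zeros`), while each curve point is
a vertex of its facet (`cornerSet_tangent`, where `d ≥ 3` is used). The `i`-th corner facet thus has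
far more vertices than any proper face outside the orbits of the corner facets, and a number that
determines `i`. An automorphism must send it to one of its own translates; as the corner facets meet
at `z` and translates of the corner are disjoint, one `g` serves all `i`.

Rigidity (`eq_one_of_fixes_facets`): after composing with `g⁻¹`, the automorphism fixes all facets
at a simple vertex, hence a full flag, and `ZeroFace.fixes_above_of_covBy` spreads this to the whole
lattice. Its engine is the simplex method, which joins the covers of a face by improving edges.

Faces are encoded as zero sets of nonnegative affine functions on the finite point set
(`faceLatticeIso`), which turns all geometry into linear inequalities. -/

/-! ### Face lattices as zero sets, and rigidity of their automorphisms. -/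

section ZeroFaces

variable {ι : Type*}

/-- `Z` is the zero set of a nonnegative member of the function space `W`. -/
def IsZeroFace (W : Submodule ℝ (ι → ℝ)) (Z : Set ι) : Prop :=
  ∃ f ∈ W, (∀ i, 0 ≤ f i) ∧ Z = {i | f i = 0}

/-- The zero sets of the nonnegative members of `W`, ordered by inclusion. -/
abbrev ZeroFace (W : Submodule ℝ (ι → ℝ)) : Type _ := {Z : Set ι // IsZeroFace W Z}

variable {W : Submodule ℝ (ι → ℝ)}

theorem IsZeroFace.inter {Z Z' : Set ι} (h : IsZeroFace W Z) (h' : IsZeroFace W Z') :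
    IsZeroFace W (Z ∩ Z') := by
  obtain ⟨f, hf, hf0, rfl⟩ := h
  obtain ⟨g, hg, hg0, rfl⟩ := h'
  refine ⟨f + g, W.add_mem hf hg, fun i => add_nonneg (hf0 i) (hg0 i), ?_⟩
  ext i
  have := hf0 i
  have := hg0 i
  simp only [Set.mem_inter_iff, Set.mem_ofPred_eq, Pi.add_apply]
  constructor
  · rintro ⟨h1, h2⟩; linarith
  · intro h; constructor <;> linarith

theorem isZeroFace_univ : IsZeroFace W Set.univ :=
  ⟨0, W.zero_mem, by simp, by simp⟩

/-- A face of a face is a face. -/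
theorem IsZeroFace.restrict [Finite ι] {w : Set ι} (hw : IsZeroFace W w) {f : ι → ℝ} (hf : f ∈ W)
    (hf0 : ∀ i ∈ w, 0 ≤ f i) : IsZeroFace W {i | i ∈ w ∧ f i = 0} := by
  classical
  cases nonempty_fintype ι
  obtain ⟨e, he, he0, rfl⟩ := hw
  -- Where `e i = 0` the quotient is `0` by convention, so `N` dominates exactly the ratios off `w`.
  set N : ℝ := ∑ i, |f i| / e i + 1
  have key : ∀ i, 0 < e i → 0 < f i + N * e i := by
    intro i hi
    have h1 : |f i| / e i ≤ ∑ i, |f i| / e i :=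
      Finset.single_le_sum (f := fun i => |f i| / e i)
        (fun j _ => div_nonneg (abs_nonneg _) (he0 j)) (Finset.mem_univ i)
    have h2 : |f i| ≤ (∑ i, |f i| / e i) * e i := (div_le_iff₀ hi).1 h1
    have h3 := neg_abs_le (f i)
    simp only [N]
    nlinarith
  refine ⟨f + N • e, W.add_mem hf (W.smul_mem _ he), fun i => ?_, ?_⟩
  · rcases (he0 i).eq_or_lt with h | h
    · simpa [← h] using hf0 i h.symm
    · simpa using (key i h).le
  · ext i
    simp only [Set.mem_ofPred_eq, Pi.add_apply, Pi.smul_apply, smul_eq_mul]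
    constructor
    · rintro ⟨h1, h2⟩; simp [h1, h2]
    · intro h
      rcases (he0 i).eq_or_lt with h' | h'
      · rw [← h'] at h ⊢
        simpa using h
      · exact absurd h (key i h').ne'

/-- Moving from `p` in direction `f` until the first coordinate in `w` vanishes. -/
theorem exists_pivot [Finite ι] {w : Set ι} {p f : ι → ℝ} (hp : ∀ j ∈ w, 0 ≤ p j)
    (hpf : ∀ j ∈ w, f j < 0 → 0 < p j) (hf : ∃ j ∈ w, f j < 0) :
    ∃ t : ℝ, 0 < t ∧ (∀ j ∈ w, 0 ≤ p j + t * f j) ∧ ∃ j ∈ w, f j < 0 ∧ p j + t * f j = 0 := by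
  obtain ⟨k, ⟨hkw, hk⟩, hmin⟩ := Set.exists_min_image {j | j ∈ w ∧ f j < 0}
    (fun j => p j / (-f j)) (Set.toFinite _) (by obtain ⟨j, h1, h2⟩ := hf; exact ⟨j, h1, h2⟩)
  have hk' : 0 < -f k := by linarith
  refine ⟨p k / (-f k), div_pos (hpf k hkw hk) hk', fun j hj => ?_, k, hkw, hk, ?_⟩
  · by_cases h : f j < 0
    · have h1 := hmin j ⟨hj, h⟩
      have h2 : p k / (-f k) * (-f j) ≤ p j := (le_div_iff₀ (by linarith)).1 h1
      linarith
    · exact add_nonneg (hp j hj)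
        (mul_nonneg (div_pos (hpf k hkw hk) hk').le (not_lt.1 h))
  · have : f k ≠ 0 := hk.ne
    field_simp
    ring

theorem ZeroFace.exists_mem_not_mem {F w : ZeroFace W} (h : F < w) : ∃ i, i ∈ w.1 ∧ i ∉ F.1 :=
  Set.exists_of_ssubset h

/-- Modulo functions vanishing on `w`, those vanishing on `F` form a line. If `f` were negative
somewhere on `w`, tilting the function exposing `F` by `f` up to the first new zero would expose a
face strictly between `F` and `w`, since `i` stays outside it. Apply this to `f` and `-f`. -/
theorem ZeroFace.covBy_vanish [Finite ι] {F w : ZeroFace W} (h : F ⋖ w) {i : ι} (hiw : i ∈ w.1)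
    (hiF : i ∉ F.1) {f : ι → ℝ} (hf : f ∈ W) (hfF : ∀ j ∈ F.1, f j = 0) (hfi : f i = 0) :
    ∀ j ∈ w.1, f j = 0 := by
  have main : ∀ f ∈ W, (∀ j ∈ F.1, f j = 0) → f i = 0 → ∀ j ∈ w.1, 0 ≤ f j := by
    intro f hf hfF hfi j hj
    by_contra! hneg
    obtain ⟨p, hp, hp0, hpF⟩ := F.2
    have hFp : ∀ j, j ∈ F.1 ↔ p j = 0 := fun j => by rw [hpF]; rfl
    obtain ⟨t, -, h1, k, hkw, hk, hk0⟩ := exists_pivot (w := w.1) (p := p) (f := f)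
      (fun j _ => hp0 j) (fun j _ hj => (hp0 j).lt_of_ne'
        (fun h0 => hj.ne (hfF j ((hFp j).2 h0)))) ⟨j, hj, hneg⟩
    have hX := w.2.restrict (f := p + t • f) (W.add_mem hp (W.smul_mem _ hf)) h1
    refine h.2 (c := ⟨_, hX⟩) ?_ ?_
    · refine (Set.ssubset_iff_of_subset ?_).2 ⟨k, ⟨hkw, hk0⟩, fun hkF => hk.ne (hfF k hkF)⟩
      intro j hj
      refine ⟨h.1.le hj, ?_⟩
      simp [(hFp j).1 hj, hfF j hj]
    · refine (Set.ssubset_iff_of_subset (fun j hj => hj.1)).2 ⟨i, hiw, fun hi => hiF ?_⟩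
      have := hi.2
      simpa [hfi, hFp] using this
  intro j hj
  refine le_antisymm ?_ (main f hf hfF hfi j hj)
  have := main (-f) (W.neg_mem hf) (fun j hj => by simp [hfF j hj]) (by simp [hfi]) j hj
  simpa using this

theorem ZeroFace.covBy_inter {F w w' : ZeroFace W} (h : F ⋖ w) (h' : F ⋖ w') (hne : w ≠ w')
    {i : ι} (hi : i ∈ w.1) (hi' : i ∈ w'.1) : i ∈ F.1 := by
  by_contra hiF
  have h1 : F < ⟨_, w.2.inter w'.2⟩ :=
    (Set.ssubset_iff_of_subset (Set.subset_inter h.1.le h'.1.le)).2 ⟨i, ⟨hi, hi'⟩, hiF⟩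
  have h2 : (⟨_, w.2.inter w'.2⟩ : ZeroFace W) = w :=
    (h.eq_or_eq h1.le Set.inter_subset_left).resolve_left h1.ne'
  have h3 : (⟨_, w.2.inter w'.2⟩ : ZeroFace W) = w' :=
    (h'.eq_or_eq h1.le Set.inter_subset_right).resolve_left h1.ne'
  exact hne (h2.symm.trans h3)

/-- Below a cover of a cover of `F` there are at most two covers of `F`. -/
theorem ZeroFace.diamond [Finite ι] {F w₁ w₂ w₃ S : ZeroFace W} (h₁ : F ⋖ w₁) (h₂ : F ⋖ w₂)
    (h₃ : F ⋖ w₃) (hS : w₁ ⋖ S) (hS₂ : w₂ ≤ S) (hS₃ : w₃ ≤ S) (h12 : w₁ ≠ w₂) (h13 : w₁ ≠ w₃) :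
    w₂ = w₃ := by
  by_contra h23
  obtain ⟨i₁, hi₁, hi₁F⟩ := ZeroFace.exists_mem_not_mem h₁.1
  obtain ⟨i₂, hi₂, hi₂F⟩ := ZeroFace.exists_mem_not_mem h₂.1
  obtain ⟨i₃, hi₃, hi₃F⟩ := ZeroFace.exists_mem_not_mem h₃.1
  have hexp : ∀ w : ZeroFace W, F ⋖ w → ∃ e ∈ W, (∀ i, i ∈ w.1 → e i = 0) ∧
      (∀ i, i ∉ w.1 → 0 < e i) := by
    rintro ⟨w, e, he, he0, rfl⟩ -
    exact ⟨e, he, fun i hi => hi, fun i hi => (he0 i).lt_of_ne' hi⟩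
  obtain ⟨e₁, he₁, hz₁, hp₁⟩ := hexp w₁ h₁
  obtain ⟨e₂, he₂, hz₂, hp₂⟩ := hexp w₂ h₂
  obtain ⟨e₃, he₃, hz₃, hp₃⟩ := hexp w₃ h₃
  have a12 : i₁ ∉ w₂.1 := fun h => hi₁F (ZeroFace.covBy_inter h₁ h₂ h12 hi₁ h)
  have a13 : i₁ ∉ w₃.1 := fun h => hi₁F (ZeroFace.covBy_inter h₁ h₃ h13 hi₁ h)
  have a21 : i₂ ∉ w₁.1 := fun h => hi₂F (ZeroFace.covBy_inter h₁ h₂ h12 h hi₂)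
  have a23 : i₂ ∉ w₃.1 := fun h => hi₂F (ZeroFace.covBy_inter h₂ h₃ h23 hi₂ h)
  have a31 : i₃ ∉ w₁.1 := fun h => hi₃F (ZeroFace.covBy_inter h₁ h₃ h13 h hi₃)
  have a32 : i₃ ∉ w₂.1 := fun h => hi₃F (ZeroFace.covBy_inter h₂ h₃ h23 h hi₃)
  have p1 := hp₂ _ a12
  have p2 := hp₃ _ a13
  have p3 := hp₁ _ a21
  have p4 := hp₃ _ a23
  have p5 := hp₁ _ a31
  have p6 := hp₂ _ a32
  have hF₁ : ∀ j ∈ F.1, e₁ j = 0 := fun j hj => hz₁ j (h₁.1.le hj)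
  have hF₂ : ∀ j ∈ F.1, e₂ j = 0 := fun j hj => hz₂ j (h₂.1.le hj)
  have hF₃ : ∀ j ∈ F.1, e₃ j = 0 := fun j hj => hz₃ j (h₃.1.le hj)
  -- The coefficients make `f` vanish at `i₁`, and those of `k` below make `k` vanish on `w₁` and at
  -- `i₂`. Hence `k` vanishes on `S`, although at `i₃` it is a sum of positive terms.
  set f : ι → ℝ := e₃ i₁ • e₂ - e₂ i₁ • e₃ with hf
  have hfW : f ∈ W := W.sub_mem (W.smul_mem _ he₂) (W.smul_mem _ he₃)
  have hfw : ∀ j ∈ w₁.1, f j = 0 :=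
    ZeroFace.covBy_vanish h₁ hi₁ hi₁F hfW (fun j hj => by simp [hf, hF₂ j hj, hF₃ j hj])
      (by simp [hf]; ring)
  set k : ι → ℝ := e₁ i₂ • f + (e₂ i₁ * e₃ i₂) • e₁ with hk
  have hkS := ZeroFace.covBy_vanish hS (hS₂ hi₂) a21 (f := k)
    (W.add_mem (W.smul_mem _ hfW) (W.smul_mem _ he₁))
    (fun j hj => by simp [hk, hfw j hj, hz₁ j hj])
    (by simp [hk, hf, hz₂ i₂ hi₂]; ring) i₃ (hS₃ hi₃)
  have : k i₃ = e₁ i₂ * (e₃ i₁ * e₂ i₃) + e₂ i₁ * e₃ i₂ * e₁ i₃ := by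
    simp [hk, hf, hz₃ i₃ hi₃]
  have : 0 < k i₃ := by rw [this]; positivity
  exact this.ne' hkS

/-- Subtracting from the function exposing `F` a multiple of the one exposing `w` leaves it positive
on `w` outside `F`. The first new zero on `S` gives a face above `F` not containing `w`. -/
theorem ZeroFace.exists_other_covBy [Finite ι] {F w S : ZeroFace W} (h : F ⋖ w) (hS : w < S) :
    ∃ w', F ⋖ w' ∧ w' ≤ S ∧ w' ≠ w := by
  obtain ⟨p, hp, hp0, hpF⟩ := F.2
  have hFp : ∀ j, j ∈ F.1 ↔ p j = 0 := fun j => by rw [hpF]; rfl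
  obtain ⟨e, he, he0, hew⟩ := w.2
  have hwe : ∀ j, j ∈ w.1 ↔ e j = 0 := fun j => by rw [hew]; rfl
  obtain ⟨j, hjS, hjw⟩ := ZeroFace.exists_mem_not_mem hS
  have hlt : ∀ j, (-e) j < 0 → j ∉ w.1 := fun j hj hjw => by simp [(hwe j).1 hjw] at hj
  obtain ⟨t, -, h1, k, hkS, hk, hk0⟩ := exists_pivot (w := S.1) (p := p) (f := -e)
    (fun j _ => hp0 j) (fun j _ hj => (hp0 j).lt_of_ne'
      (fun h0 => hlt j hj (h.1.le ((hFp j).2 h0))))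
    ⟨j, hjS, by simpa using (he0 j).lt_of_ne' (fun h0 => hjw ((hwe j).2 h0))⟩
  have hX := S.2.restrict (f := p + t • (-e)) (W.add_mem hp (W.smul_mem _ (W.neg_mem he))) h1
  have hFX : F < ⟨_, hX⟩ := by
    refine (Set.ssubset_iff_of_subset ?_).2 ⟨k, ⟨hkS, hk0⟩, fun hkF => hlt k hk (h.1.le hkF)⟩
    intro j hj
    refine ⟨hS.le (h.1.le hj), ?_⟩
    simp [(hFp j).1 hj, (hwe j).1 (h.1.le hj)]
  obtain ⟨w', hw', hle⟩ := exists_covBy_le_of_lt hFX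
  refine ⟨w', hw', fun j hj => (hle hj).1, ?_⟩
  rintro rfl
  obtain ⟨i, hi, hiF⟩ := ZeroFace.exists_mem_not_mem h.1
  have := (hle hi).2
  simp [(hwe i).1 hi] at this
  exact hiF ((hFp i).2 this)

/-- Simplex step: a cover `w` of `F` other than `w₀` has a neighbouring cover of `F` on which the
functional exposing `w₀` is smaller. -/
theorem ZeroFace.exists_improving_covBy [Finite ι] {F w₀ w : ZeroFace W} (h₀ : F ⋖ w₀) (h : F ⋖ w)
    (hne : w ≠ w₀) {p e₀ : ι → ℝ} (hp : p ∈ W) (hp0 : ∀ i, 0 ≤ p i)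
    (hFp : ∀ j, j ∈ F.1 ↔ p j = 0) (he₀ : e₀ ∈ W) (he₀0 : ∀ i, 0 ≤ e₀ i)
    (hwe₀ : ∀ j, j ∈ w₀.1 ↔ e₀ j = 0) {i : ι} (hi : i ∈ w.1) (hiF : i ∉ F.1) :
    ∃ S w', w ⋖ S ∧ F ⋖ w' ∧ w' ≤ S ∧ w' ≠ w ∧
      ∀ j ∈ w'.1, j ∉ F.1 → e₀ j / p j < e₀ i / p i := by
  have hpos : ∀ j, j ∉ F.1 → 0 < p j := fun j hj => (hp0 j).lt_of_ne' (fun h0 => hj ((hFp j).2 h0))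
  have hi₀ : i ∉ w₀.1 := fun hi' => hiF (ZeroFace.covBy_inter h h₀ hne hi hi')
  have hc : 0 < e₀ i / p i :=
    div_pos ((he₀0 i).lt_of_ne' (fun h0 => hi₀ ((hwe₀ i).2 h0))) (hpos i hiF)
  set c := e₀ i / p i with hcdef
  obtain ⟨e, he, he0, hew⟩ := w.2
  have hwe : ∀ j, j ∈ w.1 ↔ e j = 0 := fun j => by rw [hew]; rfl
  have hFe₀ : ∀ j ∈ F.1, e₀ j = 0 := fun j hj => (hwe₀ j).1 (h₀.1.le hj)
  -- The sign of `f` compares the objective `e₀ / p` with its value `c` on `w`. Tilting `e` by `f`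
  -- exposes a larger face on which `f` is negative off `w`.
  set f : ι → ℝ := e₀ - c • p with hf
  have hfW : f ∈ W := W.sub_mem he₀ (W.smul_mem _ hp)
  have hfw : ∀ j ∈ w.1, f j = 0 := by
    refine ZeroFace.covBy_vanish h hi hiF hfW (fun j hj => ?_) ?_
    · simp [hf, hFe₀ j hj, (hFp j).1 hj]
    · simp [hf, hcdef, div_mul_cancel₀ _ (hpos i hiF).ne']
  obtain ⟨j₀, hj₀, hj₀F⟩ := ZeroFace.exists_mem_not_mem h₀.1
  obtain ⟨t, ht, h1, k, -, hk, hk0⟩ := exists_pivot (w := Set.univ) (p := e) (f := f)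
    (fun j _ => he0 j) (fun j _ hj => (he0 j).lt_of_ne'
      (fun h0 => hj.ne (hfw j ((hwe j).2 h0))))
    ⟨j₀, trivial, by simpa [hf, (hwe₀ j₀).1 hj₀] using mul_pos hc (hpos j₀ hj₀F)⟩
  have hH : IsZeroFace W {j | (e + t • f) j = 0} :=
    ⟨_, W.add_mem he (W.smul_mem _ hfW), fun j => h1 j trivial, rfl⟩
  have hwH : w < ⟨_, hH⟩ := by
    refine (Set.ssubset_iff_of_subset ?_).2 ⟨k, hk0, fun hkw => hk.ne (hfw k hkw)⟩
    intro j hj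
    simp [(hwe j).1 hj, hfw j hj]
  obtain ⟨S, hS, hSH⟩ := exists_covBy_le_of_lt hwH
  obtain ⟨w', hw', hw'S, hw'ne⟩ := ZeroFace.exists_other_covBy h hS.1
  refine ⟨S, w', hS, hw', hw'S, hw'ne, fun j hj hjF => ?_⟩
  have hjw : j ∉ w.1 := fun hjw => hjF (ZeroFace.covBy_inter hw' h hw'ne hj hjw)
  have hej : 0 < e j := (he0 j).lt_of_ne' (fun h0 => hjw ((hwe j).2 h0))
  have h2 : e j + t * f j = 0 := hSH (hw'S hj)
  have h3 : f j < 0 := by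
    by_contra! h4
    have := mul_nonneg ht.le h4
    linarith
  rw [div_lt_iff₀ (hpos j hjF)]
  simpa [hf] using h3

/-- An automorphism that fixes `F` and everything above some cover of `F` fixes everything
above `F`. -/
theorem ZeroFace.fixes_above_of_covBy [Finite ι] (φ : ZeroFace W ≃o ZeroFace W) (F : ZeroFace W) :
    φ F = F → ∀ w₀, F ⋖ w₀ → (∀ T, w₀ ≤ T → φ T = T) → ∀ T, F ≤ T → φ T = T := by
  induction F using WellFoundedGT.induction with
  | ind F ih =>
  intro hF w₀ h₀ hfix₀
  obtain ⟨p, hp, hp0, hpF⟩ := F.2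
  have hFp : ∀ j, j ∈ F.1 ↔ p j = 0 := fun j => by rw [hpF]; rfl
  obtain ⟨e₀, he₀, he₀0, hew₀⟩ := w₀.2
  have hwe₀ : ∀ j, j ∈ w₀.1 ↔ e₀ j = 0 := fun j => by rw [hew₀]; rfl
  have key : ∀ w, F ⋖ w → ∀ T, w ≤ T → φ T = T := by
    by_contra! hbad
    obtain ⟨wb, hwb, Tb, hTb, hTb'⟩ := hbad
    obtain ⟨ib, hib, hibF⟩ := ZeroFace.exists_mem_not_mem hwb.1
    -- Take a bad cover with least objective. Its improving neighbour `w'` is good, so `S` is fixed;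
    -- the diamond property then fixes `w`, and induction at `w` with the cover `S` makes `w` good.
    obtain ⟨⟨w, i⟩, ⟨hw, hi, hiF, hwbad⟩, hmin⟩ := Set.exists_min_image
      {x : ZeroFace W × ι | F ⋖ x.1 ∧ x.2 ∈ x.1.1 ∧ x.2 ∉ F.1 ∧ ¬ ∀ T, x.1 ≤ T → φ T = T}
      (fun x => e₀ x.2 / p x.2) (Set.toFinite _)
      ⟨(wb, ib), hwb, hib, hibF, fun hall => hTb' (hall Tb hTb)⟩
    dsimp only at hw hi hiF hwbad
    have hne : w ≠ w₀ := by rintro rfl; exact hwbad hfix₀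
    obtain ⟨S, w', hS, hw', hw'S, hw'ne, hlt⟩ := ZeroFace.exists_improving_covBy h₀ hw hne hp hp0
      hFp he₀ he₀0 hwe₀ hi hiF
    have hfix' : ∀ T, w' ≤ T → φ T = T := by
      by_contra hb
      obtain ⟨j, hj, hjF⟩ := ZeroFace.exists_mem_not_mem hw'.1
      exact absurd (hmin (w', j) ⟨hw', hj, hjF, hb⟩) (not_le.2 (hlt j hj hjF))
    have hφS : φ S = S := hfix' S hw'S
    have hφw : φ w = w := by
      by_contra hb
      have hcov : F ⋖ φ w := by
        have := (apply_covBy_apply_iff φ).2 hw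
        rwa [hF] at this
      have hφS' : φ w ≤ S := by
        have := φ.monotone hS.1.le
        rwa [hφS] at this
      have := ZeroFace.diamond hw hw' hcov hS hw'S hφS' hw'ne.symm (Ne.symm hb)
      rw [← hfix' w' le_rfl] at this
      exact hw'ne (φ.injective this)
    exact hwbad (ih w hw.1 hφw S hS (fun T hT => hfix' T (hw'S.trans hT)))
  intro T hT
  rcases hT.eq_or_lt with rfl | hlt
  · exact hF
  · obtain ⟨w, hw, hwT⟩ := exists_covBy_le_of_lt hlt
    exact key w hw T hwT

end ZeroFaces

/-! ### The corner and its moment curves. -/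

section Corner

/-- Points of the moment curve in the coordinate hyperplane `x i = 0`. -/
noncomputable def curvePoint {d : ℕ} (i : Fin d) (t : ℕ) : Fin d → ℝ :=
  fun j => if j = i then 0 else (t : ℝ) ^ ((j - i : Fin d) : ℕ)

/-- A finite subset of the nonnegative orthant, consisting of the origin, the unit vectors and
`N i` points on the moment curve in the `i`-th coordinate hyperplane. -/
def cornerSet {d : ℕ} (N : Fin d → ℕ) : Set (Fin d → ℝ) :=
  {0} ∪ Set.range (fun i => Pi.single i 1) ∪ ⋃ i, curvePoint i '' Set.Ico 3 (N i + 3)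

variable {d : ℕ} {N : Fin d → ℕ}

theorem zero_mem_cornerSet : (0 : Fin d → ℝ) ∈ cornerSet N := Or.inl (Or.inl rfl)

theorem single_mem_cornerSet (i : Fin d) : (Pi.single i 1 : Fin d → ℝ) ∈ cornerSet N :=
  Or.inl (Or.inr ⟨i, rfl⟩)

theorem curvePoint_mem_cornerSet {i : Fin d} {t : ℕ} (ht : t ∈ Set.Ico 3 (N i + 3)) :
    curvePoint i t ∈ cornerSet N :=
  Or.inr (Set.mem_iUnion.2 ⟨i, t, ht, rfl⟩)

theorem cornerSet_cases {a : Fin d → ℝ} (ha : a ∈ cornerSet N) :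
    a = 0 ∨ (∃ i, a = Pi.single i 1) ∨ ∃ i, ∃ t ∈ Set.Ico 3 (N i + 3), a = curvePoint i t := by
  rcases ha with (h | ⟨i, rfl⟩) | h
  · exact Or.inl h
  · exact Or.inr (Or.inl ⟨i, rfl⟩)
  · obtain ⟨i, t, ht, rfl⟩ := Set.mem_iUnion.1 h
    exact Or.inr (Or.inr ⟨i, t, ht, rfl⟩)

theorem cornerSet_finite (N : Fin d → ℕ) : (cornerSet N).Finite :=
  ((Set.finite_singleton _).union (Set.finite_range _)).union
    (Set.finite_iUnion fun _ => (Set.finite_Ico _ _).image _)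

theorem curvePoint_self (i : Fin d) (t : ℕ) : curvePoint i t i = 0 := by simp [curvePoint]

theorem curvePoint_pos {i j : Fin d} (h : j ≠ i) {t : ℕ} (ht : 3 ≤ t) : 0 < curvePoint i t j := by
  have : (0 : ℝ) < t := by exact_mod_cast (by omega : 0 < t)
  simp only [curvePoint, if_neg h]
  positivity

theorem cornerSet_nonneg {a : Fin d → ℝ} (ha : a ∈ cornerSet N) (j : Fin d) : 0 ≤ a j := by
  rcases cornerSet_cases ha with rfl | ⟨i, rfl⟩ | ⟨i, t, ht, rfl⟩
  · simp
  · by_cases h : j = i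
    · subst h; simp
    · simp [h]
  · by_cases h : j = i
    · rw [h, curvePoint_self]
    · exact (curvePoint_pos h ht.1).le

/-- An affine function that is not a multiple of the `i`-th coordinate vanishes at no more than `d`
points of the `i`-th moment curve. -/
theorem curvePoint_zeros [NeZero d] (i : Fin d) (c₀ : ℝ) (c : Fin d → ℝ)
    (h : ¬ (c₀ = 0 ∧ ∀ j, j ≠ i → c j = 0)) :
    {t : ℕ | c₀ + ∑ j, c j * curvePoint i t j = 0}.Finite ∧
      {t : ℕ | c₀ + ∑ j, c j * curvePoint i t j = 0}.ncard ≤ d := by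
  classical
  -- On the curve the exponents `j - i` run cyclically through `0, …, d - 1`. Exponent `0` belongs
  -- to `j = i`, whose coordinate is zero, so that slot is free for the constant term.
  set a : Fin d → ℝ := fun j => if j = i then c₀ else c j with ha
  set P : Polynomial ℝ := ∑ j, Polynomial.C (a j) * Polynomial.X ^ ((j - i : Fin d) : ℕ) with hP
  have hcoeff : ∀ k, P.coeff ((k - i : Fin d) : ℕ) = a k := by
    intro k
    rw [hP, Polynomial.finsetSum_coeff, Finset.sum_eq_single k]
    · simp
    · intro j _ hj
      rw [Polynomial.coeff_C_mul_X_pow, if_neg]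
      intro heq
      exact hj (sub_left_injective (Fin.ext heq)).symm
    · simp
  have hP0 : P ≠ 0 := by
    intro h0
    apply h
    have hz : ∀ k, a k = 0 := fun k => by rw [← hcoeff k, h0, Polynomial.coeff_zero]
    refine ⟨by simpa [ha] using hz i, fun j hj => by simpa [ha, hj] using hz j⟩
  have hdeg : P.natDegree ≤ d := by
    refine Polynomial.natDegree_sum_le_of_forall_le _ _ fun j _ => ?_
    exact (Polynomial.natDegree_C_mul_X_pow_le _ _).trans (Fin.is_lt _).le
  have heval : ∀ t : ℕ, P.eval (t : ℝ) = c₀ + ∑ j, c j * curvePoint i t j := by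
    intro t
    rw [hP, Polynomial.eval_finsetSum]
    have hc₀ : ∑ j, (if j = i then c₀ else 0) = c₀ := by simp
    conv_rhs => rw [← hc₀, ← Finset.sum_add_distrib]
    refine Finset.sum_congr rfl fun j _ => ?_
    by_cases hj : j = i
    · subst hj; simp [ha, curvePoint]
    · simp [ha, curvePoint, hj]
  have hsub : (fun t : ℕ => (t : ℝ)) '' {t : ℕ | c₀ + ∑ j, c j * curvePoint i t j = 0} ⊆
      (P.roots.toFinset : Set ℝ) := by
    rintro _ ⟨t, ht, rfl⟩
    simp only [Finset.mem_coe, Multiset.mem_toFinset, Polynomial.mem_roots hP0,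
      Polynomial.IsRoot.def, heval]
    exact ht
  have hinj : Function.Injective (fun t : ℕ => (t : ℝ)) := Nat.cast_injective
  refine ⟨Set.Finite.of_finite_image ((Finset.finite_toSet _).subset hsub) hinj.injOn, ?_⟩
  rw [← Set.ncard_image_of_injective _ hinj]
  refine (Set.ncard_le_ncard hsub (Finset.finite_toSet _)).trans ?_
  rw [Set.ncard_coe_finset]
  exact (Multiset.toFinset_card_le _).trans ((Polynomial.card_roots' P).trans hdeg)

theorem Set.ncard_iUnion_le_card_mul {α β : Type*} [Finite α] (s : α → Set β) (m : ℕ)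
    (hs : ∀ a, (s a).Finite) (h : ∀ a, (s a).ncard ≤ m) :
    (⋃ a, s a).ncard ≤ Nat.card α * m := by
  classical
  cases nonempty_fintype α
  have h1 : (⋃ a, s a) = ((Finset.univ.biUnion fun a => (hs a).toFinset : Finset β) : Set β) := by
    ext; simp
  rw [h1, Set.ncard_coe_finset, Nat.card_eq_fintype_card]
  refine Finset.card_biUnion_le_card_mul _ _ _ fun a _ => ?_
  rw [← Set.ncard_eq_toFinset_card _ (hs a)]
  exact h a

theorem cornerSet_zeros [NeZero d] (c₀ : ℝ) (c : Fin d → ℝ)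
    (h : ¬ ∃ i, c₀ = 0 ∧ ∀ j, j ≠ i → c j = 0) :
    {a ∈ cornerSet N | c₀ + ∑ j, c j * a j = 0}.ncard ≤ 1 + d + d * d := by
  have hz := fun i => curvePoint_zeros i c₀ c (fun hi => h ⟨i, hi⟩)
  set T := fun i => {t : ℕ | c₀ + ∑ j, c j * curvePoint i t j = 0}
  have hsub : {a ∈ cornerSet N | c₀ + ∑ j, c j * a j = 0} ⊆
      {0} ∪ Set.range (fun i => Pi.single i 1) ∪ ⋃ i, curvePoint i '' T i := by
    rintro a ⟨ha, ha0⟩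
    rcases cornerSet_cases ha with rfl | ⟨i, rfl⟩ | ⟨i, t, ht, rfl⟩
    · exact Or.inl (Or.inl rfl)
    · exact Or.inl (Or.inr ⟨i, rfl⟩)
    · exact Or.inr (Set.mem_iUnion.2 ⟨i, t, ha0, rfl⟩)
  have h1 : (⋃ i, curvePoint i '' T i).ncard ≤ Nat.card (Fin d) * d :=
    Set.ncard_iUnion_le_card_mul _ _ (fun i => (hz i).1.image _)
      (fun i => (Set.ncard_image_le (hz i).1).trans (hz i).2)
  have h2 : (Set.range (fun i : Fin d => (Pi.single i 1 : Fin d → ℝ))).ncard ≤ d := by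
    rw [← Set.image_univ]
    exact (Set.ncard_image_le Set.finite_univ).trans (by simp [Set.ncard_univ])
  refine (Set.ncard_le_ncard hsub (((Set.finite_singleton _).union (Set.finite_range _)).union
    (Set.finite_iUnion fun i => (hz i).1.image _))).trans ?_
  refine (Set.ncard_union_le _ _).trans (add_le_add ?_ (by simpa using h1))
  exact (Set.ncard_union_le _ _).trans (add_le_add (by simp) h2)

/-- On the `i`-th curve, coordinates `i + 1` and `i + 2` are `s` and `s ^ 2`, so the function is `(t
- s) ^ 2`: a supporting function of the parabola. Three coordinates are needed to have both besides
`i`. -/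
theorem cornerSet_tangent {n : ℕ} {N : Fin (n + 3) → ℕ} {a : Fin (n + 3) → ℝ}
    (ha : a ∈ cornerSet N) {i : Fin (n + 3)} (hi : a i = 0) {t : ℕ} (ht : 3 ≤ t) :
    0 ≤ (t : ℝ) ^ 2 - 2 * t * a (i + 1) + a (i + 2) ∧
      ((t : ℝ) ^ 2 - 2 * t * a (i + 1) + a (i + 2) = 0 ↔ a = curvePoint i t) := by
  have ht' : (3 : ℝ) ≤ t := by exact_mod_cast ht
  have e1 : ((1 : Fin (n + 3)) : ℕ) = 1 := rfl
  have e2 : ((2 : Fin (n + 3)) : ℕ) = 2 := rfl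
  have n1 : (1 : Fin (n + 3)) ≠ 0 := by intro h; simpa [e1] using congrArg Fin.val h
  have n2 : (2 : Fin (n + 3)) ≠ 0 := by intro h; exact absurd (congrArg Fin.val h) (by rw [e2]; simp)
  have n12 : (1 : Fin (n + 3)) ≠ 2 := by intro h; exact absurd (congrArg Fin.val h) (by rw [e1, e2]; simp)
  have c1 : ∀ s : ℕ, curvePoint i s (i + 1) = s := fun s => by simp [curvePoint]
  have c2 : ∀ s : ℕ, curvePoint i s (i + 2) = (s : ℝ) ^ 2 := fun s => by
    rw [curvePoint, if_neg (by simpa using n2), add_sub_cancel_left, e2]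
  have aux : ∀ x : ℝ, 0 < x → x = (t : ℝ) ^ 2 - 2 * t * a (i + 1) + a (i + 2) →
      0 ≤ (t : ℝ) ^ 2 - 2 * t * a (i + 1) + a (i + 2) ∧
      ((t : ℝ) ^ 2 - 2 * t * a (i + 1) + a (i + 2) = 0 ↔ a = curvePoint i t) := by
    rintro x hx rfl
    refine ⟨hx.le, fun h => absurd h hx.ne', ?_⟩
    rintro rfl
    rw [c1, c2] at hx
    nlinarith
  rcases cornerSet_cases ha with rfl | ⟨k, rfl⟩ | ⟨k, s, hs, rfl⟩
  · exact aux ((t : ℝ) ^ 2) (by positivity) (by simp)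
  · by_cases h1 : i + 1 = k
    · have h2 : i + 2 ≠ k := by rw [← h1]; simpa using n12.symm
      -- Positivity here requires `t > 2`, which is why the curve parameters start at `3`.
      refine aux ((t : ℝ) ^ 2 - 2 * t) (by nlinarith) ?_
      rw [h1, Pi.single_eq_same, Pi.single_eq_of_ne h2]; ring
    · by_cases h2 : i + 2 = k
      · refine aux ((t : ℝ) ^ 2 + 1) (by positivity) ?_
        rw [h2, Pi.single_eq_same, Pi.single_eq_of_ne h1]; ring
      · refine aux ((t : ℝ) ^ 2) (by positivity) ?_
        rw [Pi.single_eq_of_ne h1, Pi.single_eq_of_ne h2]; ring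
  · obtain rfl : i = k := by
      by_contra hik
      exact (curvePoint_pos hik hs.1).ne' hi
    rw [c1, c2]
    have hsq : (t : ℝ) ^ 2 - 2 * t * s + (s : ℝ) ^ 2 = ((t : ℝ) - s) ^ 2 := by ring
    rw [hsq]
    refine ⟨sq_nonneg _, fun h => ?_, fun h => ?_⟩
    · have : (t : ℝ) = s := by simpa [sub_eq_zero] using h
      rw [Nat.cast_injective this]
    · have := congrFun h (i + 1)
      rw [c1, c1] at this
      simp [this]

end Corner

/-! ### Automorphisms of a polytope with an orbit of corners. -/

section CornerConfiguration

/-- A finite set `ι` of points with an action of `G` by affine maps and with affine coordinates `y`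
in which the points lie in the closed nonnegative orthant, those on its boundary form the corner
set, and all points outside `X` are obtained from the corner by the action, freely. Membership in
`W` means being the restriction of an affine function. -/
structure CornerConfiguration {d : ℕ} (G : Type*) {ι : Type*} [Group G] [MulAction G ι]
    (W : Submodule ℝ (ι → ℝ)) (N : Fin d → ℕ) (X : Set ι) (y : ι → Fin d → ℝ) : Prop where
  mem_iff : ∀ f, f ∈ W ↔ ∃ (c₀ : ℝ) (c : Fin d → ℝ), ∀ k, f k = c₀ + ∑ j, c j * y k j
  smul_mem : ∀ (g : G) (f), f ∈ W → (fun k => f (g • k)) ∈ W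
  mem_or_pos : ∀ k, y k ∈ cornerSet N ∨ ∀ j, 0 < y k j
  exists_eq : ∀ a ∈ cornerSet N, ∃ k, y k = a
  inj : ∀ k k', y k ∈ cornerSet N → y k = y k' → k = k'
  orbit : ∀ k, k ∈ X ∨ ∃ (g : G) (k' : ι), y k' ∈ cornerSet N ∧ k = g • k'
  free : ∀ (g : G) (k), y k ∈ cornerSet N → y (g • k) ∈ cornerSet N → g = 1

/-- The action of `G` on the zero faces of a `G`-invariant function space. -/
def zeroFaceAction {G ι : Type*} [Group G] [MulAction G ι] {W : Submodule ℝ (ι → ℝ)}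
    (hW : ∀ (g : G) (f), f ∈ W → (fun k => f (g • k)) ∈ W) :
    G →* (ZeroFace W ≃o ZeroFace W) where
  toFun g :=
    { toFun := fun Z => ⟨{k | g⁻¹ • k ∈ Z.1}, by
        obtain ⟨Z, f, hf, hf0, rfl⟩ := Z
        exact ⟨_, hW g⁻¹ f hf, fun k => hf0 _, rfl⟩⟩
      invFun := fun Z => ⟨{k | g • k ∈ Z.1}, by
        obtain ⟨Z, f, hf, hf0, rfl⟩ := Z
        exact ⟨_, hW g f hf, fun k => hf0 _, rfl⟩⟩
      left_inv := fun Z => Subtype.ext (by ext k; simp)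
      right_inv := fun Z => Subtype.ext (by ext k; simp)
      map_rel_iff' := by
        intro Z Z'
        refine ⟨fun h k hk => ?_, fun h k hk => h hk⟩
        have : g • k ∈ {k | g⁻¹ • k ∈ Z'.1} := h (by simpa using hk)
        simpa using this }
  map_one' := by ext Z k; simp
  map_mul' g h := by ext Z k; simp [mul_smul]

theorem mem_zeroFaceAction {G ι : Type*} [Group G] [MulAction G ι] {W : Submodule ℝ (ι → ℝ)}
    (hW : ∀ (g : G) (f), f ∈ W → (fun k => f (g • k)) ∈ W) (g : G) (Z : ZeroFace W) (k : ι) :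
    k ∈ (zeroFaceAction hW g Z).1 ↔ g⁻¹ • k ∈ Z.1 := Iff.rfl

/-- The number of atoms below `Z`, where `B` is the least element. -/
noncomputable def atomCount {ι : Type*} {W : Submodule ℝ (ι → ℝ)} (B Z : ZeroFace W) : ℕ :=
  {A : ZeroFace W | B ⋖ A ∧ A ≤ Z}.ncard

theorem atomCount_map {ι : Type*} {W : Submodule ℝ (ι → ℝ)} {B : ZeroFace W}
    (φ : ZeroFace W ≃o ZeroFace W) (hφ : φ B = B) (Z : ZeroFace W) :
    atomCount B (φ Z) = atomCount B Z := by
  unfold atomCount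
  rw [← Set.ncard_image_of_injective {A | B ⋖ A ∧ A ≤ Z} φ.injective]
  congr 1
  ext A
  constructor
  · rintro ⟨h1, h2⟩
    refine ⟨φ.symm A, ⟨?_, ?_⟩, by simp⟩
    · rw [← apply_covBy_apply_iff φ]; simpa [hφ] using h1
    · rw [← φ.le_iff_le]; simpa using h2
  · rintro ⟨A, ⟨h1, h2⟩, rfl⟩
    refine ⟨?_, φ.monotone h2⟩
    rw [← apply_covBy_apply_iff φ] at h1
    rwa [hφ] at h1

/-- Distinct covers of `B` meet only in `B`, so picking a point of each outside `B` is injective. -/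
theorem atomCount_le {ι : Type*} [Finite ι] {W : Submodule ℝ (ι → ℝ)} {B : ZeroFace W}
    (Z : ZeroFace W) : atomCount B Z ≤ Z.1.ncard := by
  rcases isEmpty_or_nonempty ι with hι | hι
  · have : {A : ZeroFace W | B ⋖ A ∧ A ≤ Z} = ∅ :=
      Set.eq_empty_of_forall_notMem fun A hA =>
        hι.elim (ZeroFace.exists_mem_not_mem hA.1.1).choose
    rw [atomCount, this, Set.ncard_empty]
    exact Nat.zero_le _
  have hch : ∀ A : ZeroFace W, ∃ k, B ⋖ A → k ∈ A.1 ∧ k ∉ B.1 := by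
    intro A
    by_cases h : B ⋖ A
    · obtain ⟨k, hk⟩ := ZeroFace.exists_mem_not_mem h.1
      exact ⟨k, fun _ => hk⟩
    · exact ⟨hι.some, fun h' => absurd h' h⟩
  choose κ hκ using hch
  refine Set.ncard_le_ncard_of_injOn κ (fun A hA => hA.2 (hκ A hA.1).1) ?_ (Set.toFinite _)
  intro A hA A' hA' heq
  by_contra hne
  refine (hκ A hA.1).2 (ZeroFace.covBy_inter hA.1 hA'.1 hne (hκ A hA.1).1 ?_)
  rw [heq]
  exact (hκ A' hA'.1).1

theorem ZeroFace.map_univ {ι : Type*} {W : Submodule ℝ (ι → ℝ)} (φ : ZeroFace W ≃o ZeroFace W) :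
    φ ⟨Set.univ, isZeroFace_univ⟩ = ⟨Set.univ, isZeroFace_univ⟩ := by
  refine le_antisymm (Set.subset_univ _) ?_
  have : φ.symm ⟨Set.univ, isZeroFace_univ⟩ ≤ ⟨Set.univ, isZeroFace_univ⟩ := Set.subset_univ _
  simpa using φ.monotone this

namespace CornerConfiguration

variable {n : ℕ} {G ι : Type*} [Group G] [MulAction G ι] {W : Submodule ℝ (ι → ℝ)}
  {N : Fin (n + 3) → ℕ} {X : Set ι} {y : ι → Fin (n + 3) → ℝ}

section
variable (H : CornerConfiguration G W N X y)
include H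

theorem nonneg (k : ι) (j : Fin (n + 3)) : 0 ≤ y k j := by
  rcases H.mem_or_pos k with h | h
  · exact cornerSet_nonneg h j
  · exact (h j).le

theorem mem_of_eq_zero {k : ι} {j : Fin (n + 3)} (h : y k j = 0) : y k ∈ cornerSet N :=
  (H.mem_or_pos k).resolve_right fun h' => (h' j).ne' h

theorem coord_mem (j : Fin (n + 3)) : (fun k => y k j) ∈ W :=
  (H.mem_iff _).2 ⟨0, Pi.single j 1, fun k => by simp [Pi.single_apply]⟩

/-- The face in which the `j`-th coordinate vanishes. -/
def facet (j : Fin (n + 3)) : ZeroFace W :=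
  ⟨{k | y k j = 0}, _, H.coord_mem j, fun k => H.nonneg k j, rfl⟩

theorem isZeroFace_empty : IsZeroFace W ∅ :=
  ⟨fun _ => 1, (H.mem_iff _).2 ⟨1, 0, by simp⟩, fun _ => zero_le_one, by simp⟩

/-- The empty face. -/
def bot : ZeroFace W := ⟨∅, H.isZeroFace_empty⟩

theorem map_bot (φ : ZeroFace W ≃o ZeroFace W) : φ H.bot = H.bot := by
  refine le_antisymm ?_ (Set.empty_subset _)
  have : H.bot ≤ φ.symm H.bot := Set.empty_subset _
  simpa using φ.monotone this

theorem facet_ne_univ (j : Fin (n + 3)) : H.facet j ≠ ⟨Set.univ, isZeroFace_univ⟩ := by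
  intro h
  obtain ⟨k, hk⟩ := H.exists_eq _ (single_mem_cornerSet j)
  have : k ∈ (H.facet j).1 := by rw [h]; trivial
  have h1 : y k j = 0 := this
  simp [hk] at h1

/-- Pull the function exposing `Z` back by each `g`. If it is a multiple of one coordinate,
nonnegativity makes `Z` everything or a translated facet, both excluded. Otherwise `cornerSet_zeros`
bounds its zeros on that copy of the corner. -/
theorem ncard_le [Finite G] [Finite ι] (Z : ZeroFace W) (hZ : Z ≠ ⟨Set.univ, isZeroFace_univ⟩)
    (hZ' : ∀ g i, Z ≠ zeroFaceAction H.smul_mem g (H.facet i)) :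
    Z.1.ncard ≤ X.ncard + Nat.card G * (1 + (n + 3) + (n + 3) * (n + 3)) := by
  obtain ⟨f, hf, hf0, hZf⟩ := Z.2
  have hmem : ∀ k, k ∈ Z.1 ↔ f k = 0 := fun k => by rw [hZf]; rfl
  have hsub : Z.1 ⊆ X ∪ ⋃ g : G, (fun k => g • k) '' {k | y k ∈ cornerSet N ∧ f (g • k) = 0} := by
    intro k hk
    rcases H.orbit k with h | ⟨g, k', hk', rfl⟩
    · exact Or.inl h
    · exact Or.inr (Set.mem_iUnion.2 ⟨g, k', ⟨hk', (hmem _).1 hk⟩, rfl⟩)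
  refine (Set.ncard_le_ncard hsub (Set.toFinite _)).trans ((Set.ncard_union_le _ _).trans
    (add_le_add le_rfl ?_))
  refine Set.ncard_iUnion_le_card_mul _ _ (fun g => Set.toFinite _) fun g => ?_
  obtain ⟨c₀, c, hc⟩ := (H.mem_iff _).1 (H.smul_mem g f hf)
  refine (Set.ncard_image_le (Set.toFinite _)).trans ?_
  refine (Set.ncard_le_ncard_of_injOn y (t := {a ∈ cornerSet N | c₀ + ∑ j, c j * a j = 0}) ?_
    (fun k hk k' _ h => H.inj k k' hk.1 h)
    ((cornerSet_finite N).subset (Set.sep_subset _ _))).trans (cornerSet_zeros c₀ c ?_)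
  · rintro k ⟨hk, hk0⟩
    exact ⟨hk, by rw [← hc]; exact hk0⟩
  rintro ⟨i, rfl, hi⟩
  have hfi : ∀ k, f (g • k) = c i * y k i := by
    intro k
    rw [hc, zero_add, Finset.sum_eq_single i (fun j _ hj => by rw [hi j hj, zero_mul]) (by simp)]
  rcases lt_trichotomy (c i) 0 with h | h | h
  · obtain ⟨k, hk⟩ := H.exists_eq _ (single_mem_cornerSet i)
    have h1 := hf0 (g • k)
    rw [hfi, hk, Pi.single_eq_same] at h1
    linarith
  · refine hZ (Subtype.ext (Set.eq_univ_of_forall fun k => (hmem k).2 ?_))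
    have := hfi (g⁻¹ • k)
    simpa [h] using this
  · refine hZ' g i (Subtype.ext (Set.ext fun k => ?_))
    have h1 := hfi (g⁻¹ • k)
    rw [smul_inv_smul] at h1
    rw [hmem, h1, mem_zeroFaceAction]
    change _ ↔ y (g⁻¹ • k) i = 0
    simp [h.ne']

theorem ncard_facet_le (i : Fin (n + 3)) : (H.facet i).1.ncard ≤ 1 + (n + 3) + N i := by
  have hsub : y '' (H.facet i).1 ⊆ {0} ∪ Set.range (fun i : Fin (n + 3) => Pi.single i 1) ∪
      curvePoint i '' Set.Ico 3 (N i + 3) := by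
    rintro _ ⟨k, hk, rfl⟩
    have hk0 : y k i = 0 := hk
    rcases cornerSet_cases (H.mem_of_eq_zero hk) with h | ⟨j, h⟩ | ⟨j, t, ht, h⟩
    · exact Or.inl (Or.inl h)
    · exact Or.inl (Or.inr ⟨j, h.symm⟩)
    · obtain rfl : i = j := by
        by_contra hij
        rw [h] at hk0
        exact (curvePoint_pos hij ht.1).ne' hk0
      exact Or.inr ⟨t, ht, h.symm⟩
  have hinj : Set.InjOn y (H.facet i).1 := fun k hk k' _ h => H.inj k k' (H.mem_of_eq_zero hk) h
  rw [← hinj.ncard_image]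
  refine (Set.ncard_le_ncard hsub (((Set.finite_singleton _).union (Set.finite_range _)).union
    ((Set.finite_Ico _ _).image _))).trans ?_
  refine (Set.ncard_union_le _ _).trans (add_le_add ((Set.ncard_union_le _ _).trans
    (add_le_add (by simp) ?_)) ?_)
  · rw [← Set.image_univ]
    exact (Set.ncard_image_le Set.finite_univ).trans (by simp [Set.ncard_univ])
  · exact (Set.ncard_image_le (Set.finite_Ico _ _)).trans (by simp [Set.ncard_eq_toFinset_card'])

theorem le_atomCount_facet [Finite ι] (i : Fin (n + 3)) :
    N i ≤ atomCount H.bot (H.facet i) := by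
  have hcurve : ∀ t : ℕ, ∃ A : ZeroFace W, t ∈ Set.Ico 3 (N i + 3) →
      (H.bot ⋖ A ∧ A ≤ H.facet i) ∧ ∀ k ∈ A.1, y k = curvePoint i t := by
    intro t
    by_cases ht : t ∈ Set.Ico 3 (N i + 3)
    swap
    · exact ⟨H.bot, fun h => absurd h ht⟩
    obtain ⟨k, hk⟩ := H.exists_eq _ (curvePoint_mem_cornerSet ht)
    have hfW : (fun k => (t : ℝ) ^ 2 - 2 * t * y k (i + 1) + y k (i + 2)) ∈ W :=
      (H.mem_iff _).2 ⟨t ^ 2, Pi.single (i + 1) (-2 * (t : ℝ)) + Pi.single (i + 2) 1, fun k => by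
        simp [Pi.single_apply, add_mul, Finset.sum_add_distrib]; ring⟩
    have hA := (H.facet i).2.restrict hfW
      (fun k hk => (cornerSet_tangent (H.mem_of_eq_zero hk) hk ht.1).1)
    have hAk : ∀ k ∈ {k | k ∈ (H.facet i).1 ∧ (t : ℝ) ^ 2 - 2 * t * y k (i + 1) + y k (i + 2) = 0},
        y k = curvePoint i t :=
      fun k hk => ((cornerSet_tangent (H.mem_of_eq_zero hk.1) hk.1 ht.1).2).1 hk.2
    have hki : y k i = 0 := by rw [hk, curvePoint_self]
    refine ⟨⟨_, hA⟩, fun _ => ⟨⟨⟨?_, ?_⟩, fun k hk => hk.1⟩, hAk⟩⟩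
    · exact (Set.ssubset_iff_of_subset (Set.empty_subset _)).2 ⟨k, ⟨hki,
        ((cornerSet_tangent (H.mem_of_eq_zero hki) hki ht.1).2).2 hk⟩, fun h => h⟩
    · intro C hC hCA
      obtain ⟨a, ha, -⟩ := ZeroFace.exists_mem_not_mem hC
      obtain ⟨b, hb, hbC⟩ := ZeroFace.exists_mem_not_mem hCA
      have h1 := hAk a (hCA.le ha)
      have h2 := hAk b hb
      have : a = b := H.inj _ _ (H.mem_of_eq_zero (hCA.le ha).1) (h1.trans h2.symm)
      exact hbC (this ▸ ha)
  choose A hA using hcurve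
  have hcard : N i = (Set.Ico 3 (N i + 3)).ncard := by simp [Set.ncard_eq_toFinset_card']
  conv_lhs => rw [hcard]
  refine Set.ncard_le_ncard_of_injOn A (fun t ht => (hA t ht).1) ?_ (Set.toFinite _)
  intro t ht t' ht' heq
  obtain ⟨k, hk, -⟩ := ZeroFace.exists_mem_not_mem (hA t ht).1.1.1
  have h1 := (hA t ht).2 k hk
  have h2 := (hA t' ht').2 k (heq ▸ hk)
  have h3 := congrFun (h1.symm.trans h2) (i + 1)
  simpa [curvePoint] using h3

/-- The face of points whose coordinates in `J` vanish. -/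
def cornerFace (J : Finset (Fin (n + 3))) : ZeroFace W :=
  ⟨{k | ∀ j ∈ J, y k j = 0}, ∑ j ∈ J, (fun k => y k j), W.sum_mem fun j _ => H.coord_mem j,
    fun k => by
      rw [Finset.sum_apply]
      exact Finset.sum_nonneg fun j _ => H.nonneg k j, by
    ext k
    change (∀ j ∈ J, y k j = 0) ↔ (∑ j ∈ J, fun k => y k j) k = 0
    rw [Finset.sum_apply, Finset.sum_eq_zero_iff_of_nonneg fun j _ => H.nonneg k j]⟩

/-- A function exposing an intermediate face vanishes at the origin and is nonnegative at the unit
vectors, so its coefficients are nonnegative. Those outside `J` are forced to be zero, and then the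
face is not smaller than the upper one. -/
theorem cornerFace_insert_covBy {J : Finset (Fin (n + 3))} {i : Fin (n + 3)} (hi : i ∉ J) :
    H.cornerFace (insert i J) ⋖ H.cornerFace J := by
  constructor
  · obtain ⟨k, hk⟩ := H.exists_eq _ (single_mem_cornerSet i)
    refine (Set.ssubset_iff_of_subset
      fun k (hk : ∀ j ∈ insert i J, y k j = 0) j hj => hk j (Finset.mem_insert_of_mem hj)).2 ⟨k, fun j hj => ?_, fun h => ?_⟩
    · rw [hk, Pi.single_eq_of_ne]
      rintro rfl
      exact hi hj
    · have := h i (Finset.mem_insert_self _ _)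
      simp [hk] at this
  · rintro ⟨Z, hZ⟩ hlt hlt'
    obtain ⟨k, hk, hkJ⟩ := ZeroFace.exists_mem_not_mem hlt
    obtain ⟨f, hf, hf0, rfl⟩ := hZ
    obtain ⟨c₀, c, hc⟩ := (H.mem_iff f).1 hf
    obtain ⟨k₀, hk₀⟩ := H.exists_eq _ zero_mem_cornerSet
    have hc₀ : c₀ = 0 := by
      have h1 : k₀ ∈ (H.cornerFace (insert i J)).1 := fun j _ => by rw [hk₀]; rfl
      have h2 : f k₀ = 0 := hlt.le h1
      simpa [hc, hk₀] using h2
    have hce : ∀ j, ∃ k, y k = Pi.single j 1 ∧ f k = c j := by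
      intro j
      obtain ⟨k, hk⟩ := H.exists_eq _ (single_mem_cornerSet j)
      exact ⟨k, hk, by simp [hc, hk, hc₀, Pi.single_apply]⟩
    have hcnn : ∀ j, 0 ≤ c j := fun j => by
      obtain ⟨k, -, hk⟩ := hce j
      rw [← hk]
      exact hf0 k
    have hki : y k i ≠ 0 := by
      intro h0
      refine hkJ fun j hj => ?_
      rcases Finset.mem_insert.1 hj with rfl | hj
      · exact h0
      · exact hlt'.le hk j hj
    have hcJ : ∀ j, j ∉ J → c j = 0 := by
      intro j hj
      by_cases hji : j = i
      · subst hji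
        have h1 : f k = 0 := hk
        rw [hc, hc₀, zero_add, Finset.sum_eq_zero_iff_of_nonneg
          fun j _ => mul_nonneg (hcnn j) (H.nonneg k j)] at h1
        exact (mul_eq_zero.1 (h1 j (Finset.mem_univ j))).resolve_right hki
      · obtain ⟨l, hl, hlf⟩ := hce j
        have h1 : l ∈ (H.cornerFace (insert i J)).1 := fun j' hj' => by
          rw [hl, Pi.single_eq_of_ne]
          rintro rfl
          exact (Finset.mem_insert.1 hj').elim hji hj
        rw [← hlf]
        exact hlt.le h1
    obtain ⟨l, hl, hlZ⟩ := ZeroFace.exists_mem_not_mem hlt'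
    refine hlZ ?_
    change f l = 0
    rw [hc, hc₀, zero_add]
    refine Finset.sum_eq_zero fun j _ => ?_
    by_cases hj : j ∈ J
    · rw [hl j hj, mul_zero]
    · rw [hcJ j hj, zero_mul]

theorem bot_covBy_cornerFace_univ : H.bot ⋖ H.cornerFace Finset.univ := by
  have huniq : ∀ k ∈ (H.cornerFace Finset.univ).1, y k = 0 :=
    fun k hk => funext fun j => hk j (Finset.mem_univ j)
  obtain ⟨k₀, hk₀⟩ := H.exists_eq _ zero_mem_cornerSet
  refine ⟨(Set.ssubset_iff_of_subset (Set.empty_subset _)).2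
    ⟨k₀, fun j _ => by rw [hk₀]; rfl, fun h => h⟩, fun C hC hC' => ?_⟩
  obtain ⟨a, ha, -⟩ := ZeroFace.exists_mem_not_mem hC
  obtain ⟨b, hb, hbC⟩ := ZeroFace.exists_mem_not_mem hC'
  have h1 := huniq a (hC'.le ha)
  have h2 := huniq b hb
  have : a = b := H.inj _ _ (by rw [h1]; exact zero_mem_cornerSet) (h1.trans h2.symm)
  exact hbC (this ▸ ha)

/-- An automorphism that fixes the facets at the corner is trivial. -/
theorem eq_one_of_fixes_facets [Finite ι] (φ : ZeroFace W ≃o ZeroFace W)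
    (hφ : ∀ i, φ (H.facet i) = H.facet i) : φ = 1 := by
  have key : ∀ J : Finset (Fin (n + 3)), ∀ T, H.cornerFace J ≤ T → φ T = T := by
    intro J
    induction J using Finset.induction with
    | empty =>
      intro T hT
      have : T = ⟨Set.univ, isZeroFace_univ⟩ :=
        Subtype.ext (Set.eq_univ_of_forall fun k => hT (a := k) (fun j hj => by simp at hj))
      rw [this, ZeroFace.map_univ]
    | insert i J hi ih =>
      refine ZeroFace.fixes_above_of_covBy φ _ ?_ _ (H.cornerFace_insert_covBy hi) ih
      -- The new face is the meet of two fixed faces, hence fixed.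
      have h1 : ∀ Z, Z ≤ H.cornerFace (insert i J) ↔ Z ≤ H.facet i ∧ Z ≤ H.cornerFace J := by
        intro Z
        constructor
        · intro h
          exact ⟨fun k hk => h hk i (Finset.mem_insert_self _ _),
            fun k hk j hj => h hk j (Finset.mem_insert_of_mem hj)⟩
        · rintro ⟨h, h'⟩ k hk j hj
          rcases Finset.mem_insert.1 hj with rfl | hj
          · exact h hk
          · exact h' hk j hj
      have h2 := ih _ le_rfl
      have h3 : ∀ Z, φ Z ≤ H.cornerFace (insert i J) ↔ Z ≤ H.cornerFace (insert i J) := by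
        intro Z
        rw [h1, h1]
        conv_lhs => rw [← hφ i, ← h2]
        rw [φ.le_iff_le, φ.le_iff_le]
      refine le_antisymm ((h3 _).2 le_rfl) ?_
      have h4 := (h3 (φ.symm (H.cornerFace (insert i J)))).1 (by simp)
      simpa using φ.monotone h4
  refine RelIso.ext fun T => ?_
  exact ZeroFace.fixes_above_of_covBy φ _ (H.map_bot φ) _ H.bot_covBy_cornerFace_univ
    (key _) T (Set.empty_subset _)

/-- The `i`-th corner facet has between `(i + 1) * M` and `(i + 2) * M - 1` atoms. These ranges are
disjoint for different `i`, and all exceed the bound of `ncard_le` for other proper faces. -/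
theorem map_facet [Finite G] [Finite ι] {m : ℕ} (hX : X.ncard ≤ m)
    (hN : ∀ i, N i = ((i : ℕ) + 1) *
      (m + Nat.card G * (1 + (n + 3) + (n + 3) * (n + 3)) + (n + 5)))
    (φ : ZeroFace W ≃o ZeroFace W) (i : Fin (n + 3)) :
    ∃ g, φ (H.facet i) = zeroFaceAction H.smul_mem g (H.facet i) := by
  set M := m + Nat.card G * (1 + (n + 3) + (n + 3) * (n + 3)) + (n + 5) with hM
  have hlow : ∀ i : Fin (n + 3), ((i : ℕ) + 1) * M ≤ atomCount H.bot (H.facet i) :=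
    fun i => (hN i) ▸ H.le_atomCount_facet i
  have hup : ∀ i : Fin (n + 3), atomCount H.bot (H.facet i) < ((i : ℕ) + 2) * M := fun i => by
    have h1 := (atomCount_le (B := H.bot) (H.facet i)).trans (H.ncard_facet_le i)
    rw [hN i] at h1
    have h2 : n + 5 ≤ M := Nat.le_add_left _ _
    nlinarith
  have hcount : atomCount H.bot (φ (H.facet i)) = atomCount H.bot (H.facet i) :=
    atomCount_map φ (H.map_bot φ) _
  have hne : φ (H.facet i) ≠ ⟨Set.univ, isZeroFace_univ⟩ := by
    rw [← ZeroFace.map_univ φ]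
    exact fun h => H.facet_ne_univ i (φ.injective h)
  by_cases hg : ∃ g i', φ (H.facet i) = zeroFaceAction H.smul_mem g (H.facet i')
  · obtain ⟨g, i', hgi⟩ := hg
    refine ⟨g, ?_⟩
    have h1 : atomCount H.bot (H.facet i') = atomCount H.bot (H.facet i) := by
      rw [← hcount, hgi, atomCount_map _ (H.map_bot _)]
    have hlt : ∀ a b : ℕ, (a + 1) * M < (b + 2) * M → a < b + 1 := fun a b h => by
      have := Nat.lt_of_mul_lt_mul_right h
      omega
    have h2 := hlt i i' ((hlow i).trans_lt (h1 ▸ hup i'))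
    have h3 := hlt i' i ((hlow i').trans_lt (h1 ▸ hup i))
    obtain rfl : i' = i := Fin.ext (by omega)
    exact hgi
  · push Not at hg
    exfalso
    have h1 := (atomCount_le (B := H.bot) _).trans (H.ncard_le _ hne hg)
    have h2 := hlow i
    rw [hcount] at h1
    have h3 : M ≤ ((i : ℕ) + 1) * M := Nat.le_mul_of_pos_left _ (Nat.succ_pos _)
    omega

/-- The automorphism group of the faces of a corner configuration is the acting group. -/
theorem zeroFaceAction_bijective [Finite G] [Finite ι] {m : ℕ} (hX : X.ncard ≤ m)
    (hN : ∀ i, N i = ((i : ℕ) + 1) *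
      (m + Nat.card G * (1 + (n + 3) + (n + 3) * (n + 3)) + (n + 5))) :
    Function.Bijective (zeroFaceAction H.smul_mem) := by
  obtain ⟨k₀, hk₀⟩ := H.exists_eq _ zero_mem_cornerSet
  have hk₀f : ∀ i, k₀ ∈ (H.facet i).1 := fun i => by
    change y k₀ i = 0
    rw [hk₀]; rfl
  constructor
  · rw [injective_iff_map_eq_one]
    intro g hg
    have h1 : k₀ ∈ (zeroFaceAction H.smul_mem g (H.facet 0)).1 := by
      rw [hg]; exact hk₀f 0
    rw [mem_zeroFaceAction] at h1
    exact inv_eq_one.1 (H.free g⁻¹ k₀ (by rw [hk₀]; exact zero_mem_cornerSet)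
      (H.mem_of_eq_zero h1))
  · intro φ
    choose g hg using H.map_facet hX hN φ
    -- Facets `0` and `i` share the corner vertex, so their images share a point; it lies in both
    -- translates of the corner, and freeness identifies them.
    have hgg : ∀ i, g i = g 0 := by
      intro i
      set J : ZeroFace W := ⟨_, (H.facet 0).2.inter (H.facet i).2⟩
      have hJ : H.bot < J :=
        (Set.ssubset_iff_of_subset (Set.empty_subset _)).2 ⟨k₀, ⟨hk₀f 0, hk₀f i⟩, fun h => h⟩
      have hJ' : H.bot < φ J := by
        have := φ.strictMono hJ
        rwa [H.map_bot] at this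
      obtain ⟨k, hk, -⟩ := ZeroFace.exists_mem_not_mem hJ'
      have h0 : k ∈ (φ (H.facet 0)).1 := φ.monotone (show J ≤ H.facet 0 from fun k hk => hk.1) hk
      have hi : k ∈ (φ (H.facet i)).1 := φ.monotone (show J ≤ H.facet i from fun k hk => hk.2) hk
      rw [hg, mem_zeroFaceAction] at h0 hi
      have := H.free ((g i)⁻¹ * g 0) ((g 0)⁻¹ • k) (H.mem_of_eq_zero h0)
        (by rw [mul_smul, smul_inv_smul]; exact H.mem_of_eq_zero hi)
      exact (inv_mul_eq_one.1 this)
    refine ⟨g 0, ?_⟩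
    have h1 : (zeroFaceAction H.smul_mem (g 0))⁻¹ * φ = 1 := by
      refine H.eq_one_of_fixes_facets _ fun i => ?_
      rw [RelIso.mul_apply, hg i, hgg i, RelIso.inv_apply_self]
    exact inv_mul_eq_one.1 h1

end
end CornerConfiguration
end CornerConfiguration

/-! ### Exposed faces of a convex hull as zero sets. -/

section FaceLattice

variable {d : ℕ}

/-- Restrictions of affine functions to a family of points. -/
def affineFunctions {ι : Type*} (pt : ι → EuclideanSpace ℝ (Fin d)) : Submodule ℝ (ι → ℝ) where
  carrier := {f | ∃ (l : StrongDual ℝ (EuclideanSpace ℝ (Fin d))) (c : ℝ), ∀ k, f k = l (pt k) + c}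
  zero_mem' := ⟨0, 0, by simp⟩
  add_mem' := by
    rintro f f' ⟨l, c, h⟩ ⟨l', c', h'⟩
    exact ⟨l + l', c + c', fun k => by simp [h, h']; ring⟩
  smul_mem' := by
    rintro a f ⟨l, c, h⟩
    exact ⟨a • l, a * c, fun k => by simp [h]; ring⟩

variable {ι : Type*} (pt : ι → EuclideanSpace ℝ (Fin d))

theorem IsExposed.isZeroFace {F : Set (EuclideanSpace ℝ (Fin d))}
    (hF : IsExposed ℝ (convexHull ℝ (Set.range pt)) F) :
    IsZeroFace (affineFunctions pt) {k | pt k ∈ F} := by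
  rcases F.eq_empty_or_nonempty with rfl | hne
  · exact ⟨fun _ => 1, ⟨0, 1, by simp⟩, fun _ => zero_le_one, by simp⟩
  have hpt : ∀ k, pt k ∈ convexHull ℝ (Set.range pt) := fun k => subset_convexHull ℝ _ ⟨k, rfl⟩
  obtain ⟨l, rfl⟩ := hF hne
  obtain ⟨x, hx, hxmax⟩ := hne
  refine ⟨fun k => l x - l (pt k), ⟨-l, l x, fun k => by simp; ring⟩,
    fun k => sub_nonneg.2 (hxmax _ (hpt k)), ?_⟩
  ext k
  constructor
  · rintro ⟨-, h⟩
    exact sub_eq_zero.2 (le_antisymm (h x hx) (hxmax _ (hpt k)))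
  · intro h
    refine ⟨hpt k, fun y hy => ?_⟩
    rw [← sub_eq_zero.1 h]
    exact hxmax y hy

/-- By Krein–Milman `F` is the closed hull of its extreme points, which are extreme in the polytope
and so among the given points. -/
theorem IsExposed.subset_convexHull_image [Finite ι] {F : Set (EuclideanSpace ℝ (Fin d))}
    (hF : IsExposed ℝ (convexHull ℝ (Set.range pt)) F) :
    F ⊆ convexHull ℝ (pt '' {k | pt k ∈ F}) := by
  have hQ : IsCompact (convexHull ℝ (Set.range pt)) := (Set.finite_range pt).isCompact_convexHull ℝ
  have h1 := closure_convexHull_extremePoints (hF.isCompact hQ) (hF.convex (convex_convexHull ℝ _))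
  have h2 : F.extremePoints ℝ ⊆ pt '' {k | pt k ∈ F} := by
    intro x hx
    obtain ⟨k, rfl⟩ := extremePoints_convexHull_subset (hF.isExtreme.extremePoints_subset_extremePoints hx)
    exact ⟨k, hx.1, rfl⟩
  rw [← h1]
  refine closure_minimal ?_ ((Set.toFinite _).isClosed_convexHull ℝ)
  rw [h1]
  exact convexHull_mono h2

/-- The face lattice of the convex hull of a finite family of points. -/
noncomputable def faceLatticeIso [Finite ι] :
    FaceLattice (convexHull ℝ (Set.range pt)) ≃o ZeroFace (affineFunctions pt) :=
  RelIso.ofSurjective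
    (OrderEmbedding.ofMapLEIff
      (fun F : FaceLattice (convexHull ℝ (Set.range pt)) =>
        (⟨_, F.2.isZeroFace pt⟩ : ZeroFace (affineFunctions pt)))
      (fun F F' => ⟨fun h => (F.2.subset_convexHull_image pt).trans
        (convexHull_min (Set.image_subset_iff.2 h) (F'.2.convex (convex_convexHull ℝ _))),
        fun h k hk => h hk⟩)) <| by
    rintro ⟨Z, f, ⟨l, c, hf⟩, hf0, rfl⟩
    rcases Set.eq_empty_or_nonempty {k | f k = 0} with h | ⟨k₀, hk₀⟩
    · exact ⟨⟨∅, isExposed_empty⟩, Subtype.ext (by simpa using h.symm)⟩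
    · have hpt : ∀ k, pt k ∈ convexHull ℝ (Set.range pt) :=
        fun k => subset_convexHull ℝ _ ⟨k, rfl⟩
      have hmin : convexHull ℝ (Set.range pt) ⊆ {x | -c ≤ l x} := by
        refine convexHull_min ?_ (convex_halfSpace_ge l.toLinearMap.isLinear _)
        rintro _ ⟨k, rfl⟩
        have := hf0 k
        rw [hf] at this
        change -c ≤ l (pt k)
        linarith
      refine ⟨⟨_, ContinuousLinearMap.toExposed.isExposed (l := -l)⟩, Subtype.ext ?_⟩
      ext k
      constructor
      · rintro ⟨-, h⟩
        have h1 := h _ (hpt k₀)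
        have h2 : f k₀ = 0 := hk₀
        have h3 := hf0 k
        change f k = 0
        rw [hf] at *
        simp only [neg_apply] at h1
        linarith
      · intro h
        have h2 : f k = 0 := h
        refine ⟨hpt k, fun y hy => ?_⟩
        have h3 : -c ≤ l y := hmin hy
        rw [hf] at h2
        simp only [neg_apply]
        linarith

/-- Conjugation by an order isomorphism. -/
def OrderIso.conjMulEquiv {α β : Type*} [LE α] [LE β] (e : α ≃o β) : (α ≃o α) ≃* (β ≃o β) where
  toFun φ := (e.symm.trans φ).trans e
  invFun ψ := (e.trans ψ).trans e.symm
  left_inv φ := by ext; simp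
  right_inv ψ := by ext; simp
  map_mul' φ ψ := by ext; simp

end FaceLattice

/-! ### Finite isometry groups: fixed points, regular orbits, adapted coordinates. -/

section SymmetryGroup

variable {d : ℕ}

theorem IsometryEquiv.exists_linear_part (g : EuclideanSpace ℝ (Fin d) ≃ᵢ EuclideanSpace ℝ (Fin d)) :
    ∃ L : EuclideanSpace ℝ (Fin d) ≃ₗᵢ[ℝ] EuclideanSpace ℝ (Fin d), ∀ p q, g p - g q = L (p - q) :=
  ⟨g.toRealAffineIsometryEquiv.linearIsometryEquiv, fun p q =>
    (g.toRealAffineIsometryEquiv.map_vsub p q).symm⟩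

variable {P : Set (EuclideanSpace ℝ (Fin d))}

theorem geometricSymmetryGroup.apply_mem (g : geometricSymmetryGroup P)
    {x : EuclideanSpace ℝ (Fin d)} (hx : x ∈ P) : g.1 x ∈ P := by
  have : g.1 '' P = P := g.2
  exact this.subset ⟨x, hx, rfl⟩

theorem geometricSymmetryGroup.apply_mem_extremePoints (g : geometricSymmetryGroup P)
    {x : EuclideanSpace ℝ (Fin d)} (hx : x ∈ P.extremePoints ℝ) : g.1 x ∈ P.extremePoints ℝ := by
  have hinv : ∀ y, g⁻¹.1 (g.1 y) = y := fun y => g.1.symm_apply_apply y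
  refine ⟨geometricSymmetryGroup.apply_mem g hx.1, fun y hy z hz hxyz => ?_⟩
  have h1 : g⁻¹.1 (g.1 x) ∈ openSegment ℝ (g⁻¹.1 y) (g⁻¹.1 z) := by
    have := image_openSegment ℝ
      (g⁻¹.1.toRealAffineIsometryEquiv.toAffineEquiv.toAffineMap) y z
    exact this ▸ ⟨_, hxyz, rfl⟩
  rw [hinv] at h1
  have h2 := hx.2 (geometricSymmetryGroup.apply_mem g⁻¹ hy) (geometricSymmetryGroup.apply_mem g⁻¹ hz) h1
  rw [← h2]
  exact (g.1.apply_symm_apply y).symm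

theorem IsConvexPolytope.finite_extremePoints (hP : IsConvexPolytope P) :
    (P.extremePoints ℝ).Finite := by
  obtain ⟨⟨V, hV, rfl⟩, -⟩ := hP
  exact hV.subset extremePoints_convexHull_subset

theorem IsConvexPolytope.affineSpan_extremePoints (hP : IsConvexPolytope P) :
    affineSpan ℝ (P.extremePoints ℝ) = ⊤ := by
  have hfin := hP.finite_extremePoints
  obtain ⟨⟨V, hV, hPV⟩, hspan⟩ := hP
  have h1 : closure (convexHull ℝ (P.extremePoints ℝ)) = P :=
    closure_convexHull_extremePoints (hPV ▸ hV.isCompact_convexHull ℝ)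
      (hPV ▸ convex_convexHull ℝ V)
  rw [(hfin.isClosed_convexHull ℝ).closure_eq] at h1
  rw [← affineSpan_convexHull, h1, hspan]

/-- The group acts faithfully on the finitely many vertices, because they affinely span the space.
-/
theorem IsConvexPolytope.finite_geometricSymmetryGroup (hP : IsConvexPolytope P) :
    Finite (geometricSymmetryGroup P) := by
  have := hP.finite_extremePoints.to_subtype
  let ρ : geometricSymmetryGroup P → (P.extremePoints ℝ → P.extremePoints ℝ) :=
    fun g x => ⟨g.1 x, geometricSymmetryGroup.apply_mem_extremePoints g x.2⟩
  refine Finite.of_injective ρ fun g h hgh => Subtype.ext (IsometryEquiv.ext fun p => ?_)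
  have hEq : Set.EqOn (g.1.toRealAffineIsometryEquiv.toAffineEquiv.toAffineMap)
      (h.1.toRealAffineIsometryEquiv.toAffineEquiv.toAffineMap) (P.extremePoints ℝ) :=
    fun x hx => congrArg Subtype.val (congrFun hgh ⟨x, hx⟩)
  exact AffineMap.eqOn_affineSpan hEq
    (by rw [hP.affineSpan_extremePoints]; exact AffineSubspace.mem_top _ _ _)

theorem exists_fixed_point (G : Subgroup (EuclideanSpace ℝ (Fin d) ≃ᵢ EuclideanSpace ℝ (Fin d)))
    [Finite G] : ∃ o, ∀ g : G, g.1 o = o := by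
  cases nonempty_fintype G
  have hn : (Fintype.card G : ℝ) ≠ 0 := by exact_mod_cast Fintype.card_ne_zero
  refine ⟨(Fintype.card G : ℝ)⁻¹ • ∑ g : G, g.1 0, fun h => ?_⟩
  obtain ⟨L, hL⟩ := h.1.exists_linear_part
  have hL' : ∀ p, h.1 p = L p + h.1 0 := fun p => by simpa [sub_eq_iff_eq_add] using hL p 0
  have hsum : ∑ g : G, g.1 0 = ∑ g : G, (L (g.1 0) + h.1 0) := by
    rw [← Equiv.sum_comp (Equiv.mulLeft h)]
    exact Finset.sum_congr rfl fun g _ => hL' _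
  conv_rhs => rw [hsum]
  rw [hL', map_smul, map_sum, Finset.sum_add_distrib, smul_add, Finset.sum_const,
    Finset.card_univ, ← Nat.cast_smul_eq_nsmul ℝ, smul_smul, inv_mul_cancel₀ hn, one_smul]

/-- A finite group of isometries has a regular orbit. -/
theorem exists_trivial_stabilizer
    [NeZero d] (G : Subgroup (EuclideanSpace ℝ (Fin d) ≃ᵢ EuclideanSpace ℝ (Fin d))) [Finite G]
    {o : EuclideanSpace ℝ (Fin d)} (ho : ∀ g : G, g.1 o = o) :
    ∃ u, u ≠ 0 ∧ ∀ g : G, g ≠ 1 → g.1 (o + u) ≠ o + u := by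
  cases nonempty_fintype G
  choose L hL using fun g : G => g.1.exists_linear_part
  have hL' : ∀ g u, g.1 (o + u) = o + L g u := fun g u => by
    have := hL g (o + u) o
    rw [ho, add_sub_cancel_left, sub_eq_iff_eq_add'] at this
    exact this
  let K : G → Submodule ℝ (EuclideanSpace ℝ (Fin d)) :=
    fun g => LinearMap.ker ((L g).toLinearEquiv.toLinearMap - LinearMap.id)
  have hK : ∀ g u, u ∈ K g ↔ g.1 (o + u) = o + u := fun g u => by
    rw [hL']
    simp [K, sub_eq_zero]
  classical
  -- A real vector space is not a finite union of proper subspaces; `⊥` is included to force `u ≠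
  -- 0`.
  have h1 := Subspace.biUnion_ne_univ_of_top_notMem
    (s := insert ⊥ ((Finset.univ.filter fun g : G => g ≠ 1).image K)) (by
      intro htop
      rcases Finset.mem_insert.1 htop with htop | htop
      · exact top_ne_bot htop
      obtain ⟨g, hg, hgK⟩ := Finset.mem_image.1 htop
      refine (Finset.mem_filter.1 hg).2 (Subtype.ext (IsometryEquiv.ext fun p => ?_))
      have h2 : p - o ∈ K g := by rw [hgK]; trivial
      simpa using (hK g _).1 h2)
  obtain ⟨u, hu⟩ := (Set.ne_univ_iff_exists_notMem _).1 h1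
  simp only [Set.mem_iUnion, not_exists] at hu
  exact ⟨u, fun h0 => hu ⊥ (Finset.mem_insert_self _ _) h0, fun g hg hgu => hu (K g)
    (Finset.mem_insert_of_mem (Finset.mem_image.2 ⟨g, by simpa using hg, rfl⟩)) ((hK g u).2 hgu)⟩

/-- Finitely many vectors in an open half-space lie in the open positive orthant with respect to
some basis. -/
theorem exists_positive_coordinates (u : EuclideanSpace ℝ (Fin d))
    {T : Set (EuclideanSpace ℝ (Fin d))} (hT : T.Finite) (hpos : ∀ t ∈ T, 0 < inner ℝ u t) :
    ∃ Y : EuclideanSpace ℝ (Fin d) ≃ₗ[ℝ] (Fin d → ℝ), ∀ t ∈ T, ∀ i, 0 < Y t i := by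
  have h1 : ∀ᶠ δ : ℝ in nhdsWithin 0 (Set.Ioi 0), ∀ t ∈ T, ∀ i, 0 < inner ℝ u t + δ * t i := by
    refine nhdsWithin_le_nhds ((Filter.eventually_all_finite hT).2 fun t ht =>
      Filter.eventually_all.2 fun i => ?_)
    have : Filter.Tendsto (fun δ : ℝ => inner ℝ u t + δ * t i) (nhds 0)
        (nhds (inner ℝ u t + 0 * t i)) := (by fun_prop : Continuous _).tendsto 0
    exact this.eventually (lt_mem_nhds (by simpa using hpos t ht))
  -- The new coordinates are the small perturbations `⟨u, x⟩ + δ * x i`. A kernel vector would be a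
  -- multiple of the all-ones vector, and a nonzero one needs `δ = -s`.
  set s : ℝ := inner ℝ u (WithLp.toLp 2 fun _ => 1) with hs
  have h2 : ∀ᶠ δ : ℝ in nhdsWithin 0 (Set.Ioi 0), δ ≠ -s ∧ 0 < δ := by
    refine Filter.Eventually.and ?_ self_mem_nhdsWithin
    by_cases h : s = 0
    · filter_upwards [self_mem_nhdsWithin] with δ hδ
      rw [h, neg_zero]
      exact ne_of_gt hδ
    · exact nhdsWithin_le_nhds (isOpen_ne.mem_nhds (fun h0 => h (neg_eq_zero.1 h0.symm)))
  obtain ⟨δ, hδT, hδs, hδ⟩ := (h1.and h2).exists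
  let f : EuclideanSpace ℝ (Fin d) →ₗ[ℝ] (Fin d → ℝ) :=
    { toFun := fun x i => inner ℝ u x + δ * x i
      map_add' := fun x y => by ext i; simp [inner_add_right]; ring
      map_smul' := fun c x => by ext i; simp [inner_smul_right]; ring }
  have hinj : Function.Injective f := by
    rw [injective_iff_map_eq_zero]
    intro x hx
    have hxi : ∀ i, x i = -(inner ℝ u x) / δ := fun i => by
      have : inner ℝ u x + δ * x i = 0 := congrFun hx i
      field_simp
      linarith
    have hx' : x = (-(inner ℝ u x) / δ) • (WithLp.toLp 2 fun _ => 1) := by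
      ext i
      simpa using hxi i
    have h3 := congrArg (fun v => inner ℝ u v) hx'
    simp only [inner_smul_right, ← hs] at h3
    have h4 : inner ℝ u x * (δ + s) = 0 := by
      field_simp at h3
      linarith
    have h5 : inner ℝ u x = (0 : ℝ) :=
      (mul_eq_zero.1 h4).resolve_right fun h => hδs (by linarith)
    rw [hx', h5]
    simp
  exact ⟨LinearEquiv.ofInjectiveOfFinrankEq f hinj (by simp), fun t ht i => hδT t ht i⟩

end SymmetryGroup

/-! ### Building the polytope. -/

section Construction

theorem eventually_pos_add_mul {α β : ℝ} (hα : 0 < α) : ∀ᶠ R : ℝ in Filter.atTop, 0 < β + R * α := by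
  filter_upwards [Filter.eventually_gt_atTop (-β / α)] with R hR
  rw [div_lt_iff₀ hα] at hR
  linarith

/-- As `L` preserves norms, the inner product is half of `‖u - L u‖ ^ 2`. -/
theorem LinearIsometryEquiv.inner_sub_map_pos {E : Type*} [NormedAddCommGroup E]
    [InnerProductSpace ℝ E] (L : E ≃ₗᵢ[ℝ] E) {u : E} (hu : L u ≠ u) :
    0 < inner ℝ u (u - L u) := by
  have h1 : 0 < ‖u - L u‖ := norm_pos_iff.2 (sub_ne_zero.2 hu.symm)
  have h2 := norm_sub_sq_real u (L u)
  rw [L.norm_map] at h2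
  rw [inner_sub_right, real_inner_self_eq_norm_sq]
  nlinarith

theorem affineFunctions_comp {d : ℕ} {ι : Type*} {pt : ι → EuclideanSpace ℝ (Fin d)} (σ : ι → ι)
    (g : EuclideanSpace ℝ (Fin d) ≃ᵢ EuclideanSpace ℝ (Fin d)) (hσ : ∀ k, pt (σ k) = g (pt k))
    {f : ι → ℝ} (hf : f ∈ affineFunctions pt) : (fun k => f (σ k)) ∈ affineFunctions pt := by
  obtain ⟨l, c, hf⟩ := hf
  obtain ⟨L, hL⟩ := g.exists_linear_part
  refine ⟨l.comp (L.toContinuousLinearEquiv : _ →L[ℝ] _), l (g 0) + c, fun k => ?_⟩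
  have h1 : g (pt k) = L (pt k) + g 0 := by simpa [sub_eq_iff_eq_add] using hL (pt k) 0
  simp [hf, hσ, h1]
  ring

theorem mem_affineFunctions_iff {d : ℕ} {ι : Type*} {pt : ι → EuclideanSpace ℝ (Fin d)}
    (Y : EuclideanSpace ℝ (Fin d) ≃ₗ[ℝ] (Fin d → ℝ)) (z : EuclideanSpace ℝ (Fin d)) (f : ι → ℝ) :
    f ∈ affineFunctions pt ↔
      ∃ (c₀ : ℝ) (c : Fin d → ℝ), ∀ k, f k = c₀ + ∑ j, c j * Y (z - pt k) j := by
  constructor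
  · rintro ⟨l, c, hf⟩
    refine ⟨l z + c, fun j => -l (Y.symm (fun i => if j = i then 1 else 0)), fun k => ?_⟩
    have h1 := (l.toLinearMap ∘ₗ Y.symm.toLinearMap).pi_apply_eq_sum_univ (Y (z - pt k))
    have h2 : l (z - pt k) =
        ∑ j, Y (z - pt k) j * l (Y.symm (fun i => if j = i then 1 else 0)) := by
      simpa using h1
    rw [map_sub] at h2
    rw [hf]
    simp only [neg_mul, Finset.sum_neg_distrib]
    rw [Finset.sum_congr rfl fun j _ => mul_comm (l (Y.symm fun i => if j = i then 1 else 0)) _,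
      ← h2]
    ring
  · rintro ⟨c₀, c, hf⟩
    let l : EuclideanSpace ℝ (Fin d) →ₗ[ℝ] ℝ :=
      (∑ j, c j • (LinearMap.proj j : (Fin d → ℝ) →ₗ[ℝ] ℝ)) ∘ₗ Y.toLinearMap
    have hl : ∀ x, l x = ∑ j, c j * Y x j := fun x => by simp [l]
    refine ⟨-LinearMap.toContinuousLinearMap l, c₀ + l z, fun k => ?_⟩
    rw [hf, ← hl, map_sub]
    simp
    ring

/-- Given a finite group `G` of isometries preserving a finite set `X` that affinely spans the
space, adjoin to `X` the orbit of a small corner far out in a generic direction. The faces of the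
resulting polytope have automorphism group `G`. -/
theorem exists_convexPolytope_combinatorialSymmetryGroup {n : ℕ}
    (G : Subgroup (EuclideanSpace ℝ (Fin (n + 3)) ≃ᵢ EuclideanSpace ℝ (Fin (n + 3)))) [Finite G]
    {X : Set (EuclideanSpace ℝ (Fin (n + 3)))} (hX : X.Finite) (hspan : affineSpan ℝ X = ⊤)
    (hGX : ∀ g : G, ∀ x ∈ X, g.1 x ∈ X) :
    ∃ Q : Set (EuclideanSpace ℝ (Fin (n + 3))), IsConvexPolytope Q ∧
      Nonempty (CombinatorialSymmetryGroup Q ≃* G) := by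
  obtain ⟨o, ho⟩ := exists_fixed_point G
  obtain ⟨u, hu0, hu⟩ := exists_trivial_stabilizer G ho
  choose L hL using fun g : G => g.1.exists_linear_part
  have hLo : ∀ (g : G) p, g.1 p = o + L g (p - o) := fun g p => by
    rw [← hL, ho]; abel
  have hLu : ∀ g : G, g ≠ 1 → L g u ≠ u := fun g hg h => hu g hg (by
    rw [hLo, add_sub_cancel_left, h])
  obtain ⟨Y, hY⟩ := exists_positive_coordinates u
    (T := insert u ((fun g => u - L g u) '' {g : G | g ≠ 1})) ((Set.toFinite _).insert u) (by
      rintro t (rfl | ⟨g, hg, rfl⟩)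
      · rw [real_inner_self_eq_norm_sq]
        have := norm_pos_iff.2 hu0
        positivity
      · exact (L g).inner_sub_map_pos (hLu g hg))
  have hYu : ∀ i, 0 < Y u i := hY u (Set.mem_insert _ _)
  have hYg : ∀ g : G, g ≠ 1 → ∀ i, 0 < Y (u - L g u) i :=
    fun g hg => hY _ (Set.mem_insert_of_mem _ ⟨g, hg, rfl⟩)
  let N : Fin (n + 3) → ℕ := fun i => ((i : ℕ) + 1) *
    (X.ncard + Nat.card G * (1 + (n + 3) + (n + 3) * (n + 3)) + (n + 5))
  have hR₁ : ∀ᶠ R : ℝ in Filter.atTop, ∀ p ∈ X, ∀ j, 0 < Y (o - p) j + R * Y u j :=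
    (Filter.eventually_all_finite hX).2 fun p _ => Filter.eventually_all.2 fun j =>
      eventually_pos_add_mul (hYu j)
  have hR₂ : ∀ᶠ R : ℝ in Filter.atTop, ∀ g : G, ∀ a ∈ cornerSet N, ∀ j, g ≠ 1 →
      0 < Y (L g (Y.symm a)) j + R * Y (u - L g u) j :=
    Filter.eventually_all.2 fun g => (Filter.eventually_all_finite (cornerSet_finite N)).2
      fun a _ => Filter.eventually_all.2 fun j => by
        by_cases hg : g = 1
        · exact Filter.Eventually.of_forall fun R h => absurd hg h
        · filter_upwards [eventually_pos_add_mul (hYg g hg j)] with R hR _ using hR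
  -- For this `R`, seen from `z`, both `X` and all nontrivial translates of the corner lie in the
  -- open positive orthant.
  obtain ⟨R, hR₁, hR₂⟩ := (hR₁.and hR₂).exists
  set z := o + R • u with hz
  let q : (Fin (n + 3) → ℝ) → EuclideanSpace ℝ (Fin (n + 3)) := fun a => z - Y.symm a
  have hzX : ∀ p ∈ X, ∀ j, 0 < Y (z - p) j := fun p hp j => by
    have h1 : z - p = (o - p) + R • u := by rw [hz]; abel
    rw [h1, map_add, map_smul]
    exact hR₁ p hp j
  have hzg : ∀ g : G, g ≠ 1 → ∀ a ∈ cornerSet N, ∀ j, 0 < Y (z - g.1 (q a)) j := by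
    intro g hg a ha j
    have h1 : q a - o = R • u - Y.symm a := by simp only [q, hz]; abel
    have h2 : z - g.1 (q a) = L g (Y.symm a) + R • (u - L g u) := by
      rw [hLo, h1, map_sub, map_smul, hz, smul_sub]; abel
    rw [h2, map_add, map_smul]
    exact hR₂ g a ha j hg
  have hzq : ∀ a, Y (z - q a) = a := fun a => by simp [q]
  let V : Set (EuclideanSpace ℝ (Fin (n + 3))) :=
    X ∪ ⋃ g : G, (fun a => g.1 (q a)) '' cornerSet N
  have hV : V.Finite := hX.union (Set.finite_iUnion fun g => (cornerSet_finite N).image _)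
  have : Finite V := hV.to_subtype
  have hGV : ∀ g : G, ∀ p ∈ V, g.1 p ∈ V := by
    rintro g p (hp | hp)
    · exact Or.inl (hGX g p hp)
    · obtain ⟨h, a, ha, rfl⟩ := Set.mem_iUnion.1 hp
      exact Or.inr (Set.mem_iUnion.2 ⟨g * h, a, ha, rfl⟩)
  let _ : MulAction G V :=
    { smul := fun g p => ⟨g.1 p.1, hGV g p.1 p.2⟩
      one_smul := fun p => rfl
      mul_smul := fun g h p => rfl }
  have hsmul : ∀ (g : G) (p : V), (g • p).1 = g.1 p.1 := fun g p => rfl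
  have hqV : ∀ a ∈ cornerSet N, q a ∈ V :=
    fun a ha => Or.inr (Set.mem_iUnion.2 ⟨1, a, ha, rfl⟩)
  have hqY : ∀ p, p = q (Y (z - p)) := fun p => by simp [q]
  have H : CornerConfiguration G (affineFunctions (Subtype.val : V → _)) N {p : V | p.1 ∈ X}
      (fun p => Y (z - p.1)) :=
    { mem_iff := fun f => mem_affineFunctions_iff Y z f
      smul_mem := fun g f hf => affineFunctions_comp _ g.1 (hsmul g) hf
      mem_or_pos := by
        rintro ⟨p, hp | hp⟩
        · exact Or.inr (hzX p hp)
        · obtain ⟨g, a, ha, rfl⟩ := Set.mem_iUnion.1 hp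
          by_cases hg : g = 1
          · subst hg
            exact Or.inl ((hzq a).symm ▸ ha)
          · exact Or.inr (hzg g hg a ha)
      exists_eq := fun a ha => ⟨⟨q a, hqV a ha⟩, hzq a⟩
      inj := fun p p' _ h => Subtype.ext (by rw [hqY p.1, hqY p'.1, h])
      orbit := by
        rintro ⟨p, hp | hp⟩
        · exact Or.inl hp
        · obtain ⟨g, a, ha, rfl⟩ := Set.mem_iUnion.1 hp
          exact Or.inr ⟨g, ⟨q a, hqV a ha⟩, (hzq a).symm ▸ ha, rfl⟩
      free := by
        intro g p hp hgp
        by_contra hg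
        have h1 := hzg g hg _ hp
        rw [← hqY] at h1
        -- Every corner point has a zero coordinate, whereas a nontrivial translate has none.
        rcases cornerSet_cases hgp with h | ⟨i, h⟩ | ⟨i, t, -, h⟩
        · exact (h1 0).ne' (congrFun h 0)
        · obtain ⟨j, hj⟩ := exists_ne i
          exact (h1 j).ne' ((congrFun h j).trans (Pi.single_eq_of_ne hj _))
        · exact (h1 i).ne' ((congrFun h i).trans (curvePoint_self i t)) }
  refine ⟨convexHull ℝ (Set.range (Subtype.val : V → _)), ⟨⟨_, Set.finite_range _, rfl⟩, ?_⟩, ⟨?_⟩⟩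
  · rw [affineSpan_convexHull, Subtype.range_coe, ← top_le_iff, ← hspan]
    exact affineSpan_mono ℝ Set.subset_union_left
  · have hXV : {p : V | p.1 ∈ X}.ncard ≤ X.ncard :=
      Set.ncard_le_ncard_of_injOn Subtype.val (fun p hp => hp) Subtype.val_injective.injOn hX
    exact (faceLatticeIso _).conjMulEquiv.trans
      (MulEquiv.ofBijective _ (H.zeroFaceAction_bijective hXV fun _ => rfl)).symm

theorem IsGeometricGroupInDim.isCombinatorialGroupInDim {Γ : Type*} [Group Γ] {n : ℕ}
    (h : IsGeometricGroupInDim Γ (n + 3)) : IsCombinatorialGroupInDim Γ (n + 3) := by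
  obtain ⟨P, hP, ⟨e⟩⟩ := h
  have : Finite (geometricSymmetryGroup P) := hP.finite_geometricSymmetryGroup
  obtain ⟨Q, hQ, ⟨e'⟩⟩ := exists_convexPolytope_combinatorialSymmetryGroup
    (geometricSymmetryGroup P) hP.finite_extremePoints hP.affineSpan_extremePoints
    fun g x hx => geometricSymmetryGroup.apply_mem_extremePoints g hx
  exact ⟨Q, hQ, ⟨e'.trans e⟩⟩

end Construction

theorem proposition4p1 (Γ : Type*) [Group Γ] :
    (3 ≤ gcpd Γ → cpd Γ ≤ gcpd Γ) ∧
      ∀ d : ℕ, 3 ≤ d → IsGeometricGroupInDim Γ d → IsCombinatorialGroupInDim Γ d := by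
  have main : ∀ d : ℕ, 3 ≤ d → IsGeometricGroupInDim Γ d → IsCombinatorialGroupInDim Γ d := by
    intro d hd h
    obtain ⟨n, rfl⟩ := Nat.exists_eq_add_of_le' hd
    exact h.isCombinatorialGroupInDim
  refine ⟨fun h3 => le_iInf₂ fun d hd => ?_, main⟩
  have h1 : gcpd Γ ≤ d := iInf₂_le d hd
  exact iInf₂_le d (main d (by exact_mod_cast h3.trans h1) hd)
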